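/- **Setting.** Fix $T\ge 0$, $n_G\ge 0$, $n_L\ge 1$, $n_c\ge 0$. *Generators.* Generator $k\in\{1,\dots,n_G\}$ has set-points $0\le\theta_{k,1}<\dots<\theta_{k,n_k}$ and a directed graph $\Lambda_k$ of permitted switches $(l,m)$ between set-points. A switch $e=(l,m)\in\Lambda_k$ costs $K_{k,e}\ge 0$ and takes time $\delta_{k,e}>0$, during which production follows a monotone function $\theta^T_{k,e}$ on $[0,\delta_{k,e}]$ from $\theta_{k,l}$ to $\theta_{k,m}$; these functions are Lipschitz with a common constant. A mode $a=(a_k)_k\in\Gamma$ gives for each $k$ either a set-point or a transition $a_k=(l,m)\in\Lambda_k$. Put $\delta_{k,a_k}=0$ if $a_k$ is a set-point, and let $a^t$ be the mode in which every transition of $a$ is replaced by its target set-point. Let $H(a)$ be the set of $r\in\mathbb R_+^{n_G}$ with $r_k=0$ if $a_k$ is a set-point and $r_k<\delta_{k,a_k}$ otherwise. Put $\psi(a,r)=\max_k(\delta_{k,a_k}-r_k)$ (equal to $0$ if $n_G=0$), and let $\zeta(a,r)\in D_G=\prod_k[\theta_{k,1},\theta_{k,n_k}]$ have components $\theta_{k,a_k}$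 at set-points and $\theta^T_{k,a_k}(r_k)$ in transitions. *Costs.* Let $C_G:D_G\to\mathbb R$ be continuous, $c\in\mathbb R^{n_L}$ with $c>0$, $q_0,\dots,q_{n_c}\ge 0$, and let $G_0,\dots,G_{n_c}\subset\mathbb R^{n_G}\times\mathbb R_+^{n_L}$ be convex and compact such that for every $p_G\in D_G$: (i) for all $p_D\in\mathbb R^{n_L}_+$ there is $z\ge 0$ with $(p_G,p_D-z)\in G_i$; (ii) $(p_G,p_D)\in\operatorname{int}G_i$ for some $p_D$; and such that $(p_G,p_D)\in G_i$ and $0\le p_D'\le p_D$ imply $(p_G,p_D')\in G_i$ (for any $p_G$). Let $$f(x,a,r)=C_G(\zeta(a,r))+\sum_i q_i\min\{c^\top z: z\ge 0,\ (\zeta(a,r),x^+-z)\in G_i\},$$ with $x^+$ the componentwise positive part. *Demand.* Let $m$ be a Lipschitz function from $[0,T]$ to $\mathbb R_+^{n_L}$, $\gamma\ge 0$, $\sigma\in\mathbb R^{n_L\times n_L}$ non-singular, and $W$ a standard $n_L$-dimensional Brownian motion on $(\Omega,\mathcal F,\mathbb P)$. For $t\in[0,T]$ let $X^{t,x}_s=m(s)+Z_s$,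 $s\ge t$, where $dZ_s=-\gamma Z_s\,ds+\sigma\,dW_s$, $Z_t=x-m(t)$. *Problem 1.* A control is a finite random list $v=(\tau_1,\dots,\tau_N;\beta_1,\dots,\beta_N)$ with $\beta_j=(k,(l,m))$, $(l,m)\in\Lambda_k$. Starting at $t$ from $(a,r)$, generator $k$ is in the transition $a_k$ (if any) until $t-r_k+\delta_{k,a_k}$, and each request $(k,e)$ made at $\tau$ puts it in transition $e$ during $[\tau,\tau+\delta_{k,e})$; otherwise it stays at the set-point last reached. This defines the mode $\alpha(s)$ and the vector $\xi(s)$ of times spent in the current transitions ($0$ at set-points). The set $\mathcal V_{t,a,r}$ consists of the controls such that: $t\le\tau_1\le\dots\le\tau_N\le T$; the times are strictly increasing for each single generator; the $\tau_j$ are stopping times and the $\beta_j$ are $\mathcal F_{\tau_j}$-measurable for the filtration generated by $X^{t,x}$; and if $\beta_j=(k,(l,m))$, then $\alpha_k(\tau_j^-)$ is the set-point $l$ (where $\alpha(t^-)=a$). Let $$V(t,x,a,r)=\inf_{v\in\mathcal V_{t,a,r}}\mathbb E\Big[\int_t^Tf(X^{t,x}_s,\alpha(s),\xi(s))\,ds+\sum_{\tau_j\le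 T}K_{\beta_j}\Big].$$ *Problem UB.* Let $\tilde d_i(t,p_G)=\min\{\|\sigma^{-1}(p_D-m(t))\|:(p_G,p_D)\in\partial G_i\}$, and $d_i=\tilde d_i$ if $(p_G,m(t))\in G_i$, $d_i=-\tilde d_i$ otherwise. Put $$f_1^B(t,p_G,y)=C_G(p_G)+\sum_iq_i\max(0,y-d_i(t,p_G))\max_{\|\xi\|=1}c^\top(\sigma\xi)^+,\qquad f_2^B(t,y,a,w)=\max_{p_G\in D_G(a,w)}f_1^B(t,p_G,y),$$ where $D_G(a,w)$ is the closure of $\{\zeta(a,r):r\in H(a),\ \psi(a,r)=w\}$. For $y\ge 0$ let $X^{B,t,y}$ be the one-dimensional Markov process $\|\sigma^{-1}Z_s\|$, $s\ge t$, where $dZ_s=-\gamma Z_s\,ds+\sigma\,dW_s$ and $\|\sigma^{-1}Z_t\|=y$ (its law depends only on $t,y$). Starting at $t$ from $(a,w)$, the mode $\alpha^B_k(s)$ is $a_k$ for $s<t+w$ and then $a^t_k$, until the first request to $k$; each request $(k,e)$, $e=(l,m)$, made at $\tau$ puts it in transition $e$ during $[\tau,\tau+\Delta(\tau))$ and then at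 $m$ until the next request to $k$, where $\Delta(\tau)$ is the largest delay among the requests made at time $\tau$. Let $\varrho(s)=(w-(s-t))^+$ before the first request and $\varrho(s)=(w-(s-t))^++(\Delta(\tau)-(s-\tau))^+$ from then on, $\tau$ being the last request time up to $s$. The set $\mathcal V^B_{t,a,w}$ consists of the controls as above, adapted to the filtration generated by $X^{B,t,y}$, with the condition on $\alpha(\tau_j^-)$ imposed for $\alpha^B$, with all $\tau_j\in[t+w,T]$, and with $\tau_j+\Delta(\tau_j)\le\tau_{j'}$ whenever $\tau_j<\tau_{j'}$ (no requests during transitions). Let $$V^{\rm UB}(t,y,a,w)=\inf_{v\in\mathcal V^B_{t,a,w}}\mathbb E\Big[\int_t^Tf_2^B(s,X^{B,t,y}_s,\alpha^B(s),\varrho(s))\,ds+\sum_{t\le\tau_j\le T}K_{\beta_j}\Big].$$ **Theorem.** For all $t\in[0,T]$, $x\in\mathbb R^{n_L}$, $a\in\Gamma$ and $r\in H(a)$, $$V^{\rm UB}\big(t,\|\sigma^{-1}(x-m(t))\|,a,\psi(a,r)\big)\ \ge\ V(t,x,a,r).$$ -/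

import Mathlib

open MeasureTheory ProbabilityTheory Set Filter Topology
open scoped NNReal

noncomputable section

namespace PowerOps

/-- Nodal load space with the Euclidean norm. -/
abbrev Load (nL : ℕ) := EuclideanSpace ℝ (Fin nL)

/-! ### The controllable generators -/

/-- The `nG` controllable generators. Generator `k` has the set-points
`θ k 0 < ⋯ < θ k (top k)`; `Λ k` is the directed graph of permitted switches `(l, m)`; a switch
`e = (l, m)` takes `δ k e` time units, during which the production follows the curve `ramp k e`,
and costs `K k e`. (Continuity of the curves is part of the ramp-rate bound.) -/
structure Generators (nG : ℕ) where
  top : Fin nG → ℕ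
  θ : ∀ k, Fin (top k + 1) → ℝ
  Λ : ∀ k, Set (Fin (top k + 1) × Fin (top k + 1))
  δ : ∀ k, Fin (top k + 1) × Fin (top k + 1) → ℝ
  K : ∀ k, Fin (top k + 1) × Fin (top k + 1) → ℝ
  ramp : ∀ k, Fin (top k + 1) × Fin (top k + 1) → ℝ → ℝ
  θ_strictMono : ∀ k, StrictMono (θ k)
  θ_nonneg : ∀ k l, 0 ≤ θ k l
  δ_pos : ∀ k, ∀ e ∈ Λ k, 0 < δ k e
  K_nonneg : ∀ k, ∀ e ∈ Λ k, 0 ≤ K k e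
  ramp_start : ∀ k, ∀ e ∈ Λ k, ramp k e 0 = θ k e.1
  ramp_end : ∀ k, ∀ e ∈ Λ k, ramp k e (δ k e) = θ k e.2
  ramp_mono : ∀ k, ∀ e ∈ Λ k,
    MonotoneOn (ramp k e) (Icc 0 (δ k e)) ∨ AntitoneOn (ramp k e) (Icc 0 (δ k e))
  ramp_rate : ∃ C > 0, ∀ k, ∀ e ∈ Λ k, ∀ s ∈ Icc 0 (δ k e), ∀ s' ∈ Icc 0 (δ k e),
    |ramp k e s - ramp k e s'| ≤ C * |s - s'|

namespace Generators

variable {nG : ℕ} (S : Generators nG)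

/-- The permitted switches of generator `k`. -/
abbrev Edge (k : Fin nG) := {e : Fin (S.top k + 1) × Fin (S.top k + 1) // e ∈ S.Λ k}

/-- The operation mode of generator `k`: a set-point, or a transition in progress. -/
abbrev GenMode (k : Fin nG) := Fin (S.top k + 1) ⊕ S.Edge k

/-- The set `Γ` of operation modes. -/
abbrev Mode := ∀ k, S.GenMode k

/-- The set of all switching requests `(k, (l, m))`. -/
abbrev Request := Σ k, S.Edge k

/-- The box `D_G` of production levels. -/
def DG : Set (Fin nG → ℝ) :=
  {p | ∀ k, p k ∈ Icc (S.θ k 0) (S.θ k (Fin.last (S.top k)))}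

/-- `δ_{k,a_k}`, equal to `0` for a generator at a set-point. -/
def modeDelay (k : Fin nG) : S.GenMode k → ℝ
  | Sum.inl _ => 0
  | Sum.inr e => S.δ k e

/-- The set `H(a)` of transition progression vectors of the mode `a`. -/
def H (a : S.Mode) : Set (Fin nG → ℝ) :=
  {r | ∀ k, match a k with
    | Sum.inl _ => r k = 0
    | Sum.inr e => 0 ≤ r k ∧ r k < S.δ k e}

/-- `ψ(a,r) = max_k (δ_{k,a_k} - r_k)`, the time until all transitions in progress are
completed. -/
def psi (a : S.Mode) (r : Fin nG → ℝ) : ℝ := ⨆ k, (S.modeDelay k (a k) - r k)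

/-- The production `ζ(a,r)`. -/
def zeta (a : S.Mode) (r : Fin nG → ℝ) : Fin nG → ℝ := fun k =>
  match a k with
  | Sum.inl l => S.θ k l
  | Sum.inr e => S.ramp k e (r k)

/-- `D_G(a,w)`: the closure of the set of productions in mode `a` when the time until completion of
all transitions is `w`. -/
def DGw (a : S.Mode) (w : ℝ) : Set (Fin nG → ℝ) :=
  closure {p | p ∈ S.DG ∧ ∃ r ∈ S.H a, S.psi a r = w ∧ S.zeta a r = p}

/-! ### Request lists and the operation modes they produce -/

/-- A realisation `(τ_1,…,τ_N; β_1,…,β_N)` of a control. -/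
abbrev Requests := List (ℝ × S.Request)

open Classical in
/-- The last request to generator `k` made at or before time `s` (the list is in order of time). -/
def lastTo (ℓ : S.Requests) (k : Fin nG) (s : ℝ) : Option (ℝ × S.Edge k) :=
  (ℓ.filterMap fun p =>
    if h : p.2.1 = k then (if p.1 ≤ s then some (p.1, h ▸ p.2.2) else none) else none).getLast?

/-- The operation mode `α^{t,a,r}(s,v)`; for `s < t` it equals `a`. -/
def alpha (t : ℝ) (a : S.Mode) (r : Fin nG → ℝ) (ℓ : S.Requests) (s : ℝ) : S.Mode := fun k =>
  match S.lastTo ℓ k s with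
  | some (τ, e) => if s < τ + S.δ k e then Sum.inr e else Sum.inl e.1.2
  | none =>
    match a k with
    | Sum.inl l => Sum.inl l
    | Sum.inr e => if s < t - r k + S.δ k e then Sum.inr e else Sum.inl e.1.2

/-- The transition progression `ξ^{t,a,r}(s,v)`. -/
def xi (t : ℝ) (a : S.Mode) (r : Fin nG → ℝ) (ℓ : S.Requests) (s : ℝ) : Fin nG → ℝ := fun k =>
  match S.lastTo ℓ k s with
  | some (τ, e) => if s < τ + S.δ k e then s - τ else 0
  | none =>
    match a k with
    | Sum.inl _ => 0
    | Sum.inr e => if s < t - r k + S.δ k e then s - (t - r k) else 0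

open Classical in
/-- The largest delay among the requests made at time `τ`. -/
def batchDelay (ℓ : S.Requests) (τ : ℝ) : ℝ :=
  ((ℓ.filter fun p => p.1 = τ).map fun p => S.δ p.2.1 p.2.2).foldr max 0

/-- The operation mode `α^{B,t,a,w}(s,v)` of the upper bound problem, in which simultaneous
transitions count as completed together; for `s < t` it equals `a`. -/
def alphaB (t : ℝ) (a : S.Mode) (w : ℝ) (ℓ : S.Requests) (s : ℝ) : S.Mode := fun k =>
  match S.lastTo ℓ k s with
  | some (τ, e) => if s < τ + S.batchDelay ℓ τ then Sum.inr e else Sum.inl e.1.2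
  | none =>
    match a k with
    | Sum.inl l => Sum.inl l
    | Sum.inr e => if s < t + w then Sum.inr e else Sum.inl e.1.2

open Classical in
/-- The time `ϱ^{t,a,w}(s,v)` left until the transitions in progress are all completed. -/
def rho (t w : ℝ) (ℓ : S.Requests) (s : ℝ) : ℝ :=
  max 0 (w - (s - t)) +
    match (ℓ.filter fun p => p.1 ≤ s).getLast? with
    | some p => max 0 (S.batchDelay ℓ p.1 - (s - p.1))
    | none => 0

/-- The order conditions on a request list: times are nondecreasing, and strictly increasing for
each single generator. -/
def Ordered (ℓ : S.Requests) : Prop :=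
  ℓ.Pairwise fun p p' => p.1 ≤ p'.1 ∧ (p.2.1 = p'.2.1 → p.1 < p'.1)

/-- `β_j ∈ Λ(α(τ_j^-))` for all `j`, where `α` is the mode process `A`: just before `τ_j` the
generator is at the set-point from which the requested switch starts. -/
def Respects (A : ℝ → S.Mode) (ℓ : S.Requests) : Prop :=
  ∀ p ∈ ℓ, ∀ᶠ s in 𝓝[<] p.1, A s p.2.1 = Sum.inl p.2.2.1.1

/-- The pathwise conditions for a control in `𝒱_{t,a,r}`, on the horizon `[t,T]`. -/
def PathAdmissible (T t : ℝ) (a : S.Mode) (r : Fin nG → ℝ) (ℓ : S.Requests) : Prop :=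
  S.Ordered ℓ ∧ (∀ p ∈ ℓ, t ≤ p.1 ∧ p.1 ≤ T) ∧ S.Respects (S.alpha t a r ℓ) ℓ

/-- The pathwise conditions for a control in `𝒱^B_{t,a,w}`: no request before `t + w`, and none
while transitions requested at an earlier time are in progress. -/
def PathAdmissibleB (T t : ℝ) (a : S.Mode) (w : ℝ) (ℓ : S.Requests) : Prop :=
  S.Ordered ℓ ∧ (∀ p ∈ ℓ, t + w ≤ p.1 ∧ p.1 ≤ T) ∧ S.Respects (S.alphaB t a w ℓ) ℓ ∧
    ∀ p ∈ ℓ, ∀ p' ∈ ℓ, p.1 < p'.1 → p.1 + S.batchDelay ℓ p.1 ≤ p'.1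

open Classical in
/-- The switching costs `∑_{t ≤ τ_j ≤ T} K_{β_j}`. -/
def switchCost (T t : ℝ) (ℓ : S.Requests) : ℝ :=
  ((ℓ.filter fun p => t ≤ p.1 ∧ p.1 ≤ T).map fun p => S.K p.2.1 p.2.2).sum

end Generators

/-! ### Adapted controls -/

/-- `σ(Y_u : u ≤ s)`. -/
abbrev past {Ω E : Type*} [MeasurableSpace E] (Y : ℝ → Ω → E) (s : ℝ) : MeasurableSpace Ω :=
  ⨆ u ∈ Iic s, MeasurableSpace.comap (Y u) inferInstance

/-- The random request list `v` is adapted to the filtration generated by `Y`: for each `j`, the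
time `τ_j` (infinite where there is no `j`-th request) is a stopping time, and `β_j` is measurable
with respect to the `σ`-algebra of events up to `τ_j`. -/
def IsAdaptedControl {nG : ℕ} (S : Generators nG) {Ω E : Type*} [MeasurableSpace E]
    (Y : ℝ → Ω → E) (v : Ω → S.Requests) : Prop :=
  (∀ (j : ℕ) (s : ℝ), MeasurableSet[past Y s] {ω | ∃ p, (v ω)[j]? = some p ∧ p.1 ≤ s}) ∧
  ∀ (j : ℕ) (b : S.Request) (s : ℝ),
    MeasurableSet[past Y s] {ω | ∃ p, (v ω)[j]? = some p ∧ p.2 = b ∧ p.1 ≤ s}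

/-! ### The driving noise -/

/-- Standard `n`-dimensional Brownian motion with continuous paths started at `0`. -/
structure IsStdBrownian {n : ℕ} {Ω : Type*} [MeasurableSpace Ω] (P : Measure Ω)
    (W : ℝ≥0 → Ω → Load n) : Prop where
  measurable : ∀ t, Measurable (W t)
  zero : ∀ ω, W 0 ω = 0
  cont : ∀ ω, Continuous fun t => W t ω
  indep : HasIndepIncrements W P
  law : ∀ s t : ℝ≥0, s ≤ t → HasLaw (fun ω => W t ω - W s ω)
    ((stdGaussian (Load n)).map fun z => Real.sqrt ((t : ℝ) - s) • z) P

section Noise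

variable {n : ℕ} {Ω : Type*}

/-- The noise `σ (W_s - W_t)`. -/
def noise (A : Load n →L[ℝ] Load n) (W : ℝ≥0 → Ω → Load n) (t s : ℝ) (ω : Ω) : Load n :=
  A (W s.toNNReal ω - W t.toNNReal ω)

/-- The solution on `[t,∞)` of `dZ = -γ Z ds + A dW` with `Z_t = z` (see `ou_equation`), kept
equal to `z` before time `t`. -/
def ou (γ : ℝ) (A : Load n →L[ℝ] Load n) (W : ℝ≥0 → Ω → Load n) (t : ℝ) (z : Load n)
    (s : ℝ) (ω : Ω) : Load n :=
  Real.exp (-γ * (max s t - t)) •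
      (z - γ • ∫ u in t..max s t, Real.exp (γ * (u - t)) • noise A W t u ω) +
    noise A W t (max s t) ω

lemma noise_continuous (A : Load n →L[ℝ] Load n) {W : ℝ≥0 → Ω → Load n} {ω : Ω}
    (hW : Continuous fun t => W t ω) (t : ℝ) : Continuous fun s => noise A W t s ω := by
  unfold noise
  exact A.continuous.comp ((hW.comp continuous_real_toNNReal).sub continuous_const)

lemma ou_continuous (γ : ℝ) (A : Load n →L[ℝ] Load n) {W : ℝ≥0 → Ω → Load n} {ω : Ω}
    (hW : Continuous fun t => W t ω) (t : ℝ) (z : Load n) :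
    Continuous fun s => ou γ A W t z s ω := by
  have hn := noise_continuous A hW t
  have hg : Continuous fun u => Real.exp (γ * (u - t)) • noise A W t u ω := by fun_prop
  have hp : Continuous fun s => ∫ u in t..s, Real.exp (γ * (u - t)) • noise A W t u ω :=
    intervalIntegral.continuous_primitive (fun a b => hg.intervalIntegrable a b) t
  have hm : Continuous fun s : ℝ => max s t := by fun_prop
  have h1 := hp.comp hm
  have h2 := hn.comp hm
  simp only [Function.comp_def] at h1 h2
  unfold ou
  fun_prop

/-- The stochastic differential equation in integral form. -/
lemma ou_equation (γ : ℝ) (A : Load n →L[ℝ] Load n) {W : ℝ≥0 → Ω → Load n} {ω : Ω}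
    (hW : Continuous fun t => W t ω) (t : ℝ) (z : Load n) {s : ℝ} (hs : t ≤ s) :
    ou γ A W t z s ω =
      z - γ • (∫ u in t..s, ou γ A W t z u ω) + A (W s.toNNReal ω - W t.toNNReal ω) := by
  have hn := noise_continuous A hW t
  have hg : Continuous fun u => Real.exp (γ * (u - t)) • noise A W t u ω := by fun_prop
  set Q : ℝ → Load n := fun s => Real.exp (-γ * (s - t)) •
      (z - γ • ∫ u in t..s, Real.exp (γ * (u - t)) • noise A W t u ω) with hQ
  have hou : ∀ u, t ≤ u → ou γ A W t z u ω = Q u + noise A W t u ω := by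
    intro u hu
    simp only [ou, hQ, max_eq_left hu]
  have hQd : ∀ u, HasDerivAt Q (-γ • (Q u + noise A W t u ω)) u := by
    intro u
    have h1 : HasDerivAt (fun s => ∫ u in t..s, Real.exp (γ * (u - t)) • noise A W t u ω)
        (Real.exp (γ * (u - t)) • noise A W t u ω) u :=
      intervalIntegral.integral_hasDerivAt_right (hg.intervalIntegrable _ _)
        hg.aestronglyMeasurable.stronglyMeasurableAtFilter hg.continuousAt
    have h2 : HasDerivAt (fun s => Real.exp (-γ * (s - t)))
        (Real.exp (-γ * (u - t)) * (-γ)) u := by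
      have := (((hasDerivAt_id u).sub_const t).const_mul (-γ)).exp
      simpa using this
    have h3 := h2.smul ((h1.const_smul γ).const_sub z)
    refine h3.congr_deriv ?_
    have he : Real.exp (-γ * (u - t)) * Real.exp (γ * (u - t)) = 1 := by
      rw [← Real.exp_add]; simp
    have h4 : Real.exp (-γ * (u - t)) • -(γ • Real.exp (γ * (u - t)) • noise A W t u ω) =
        -γ • noise A W t u ω := by
      rw [smul_comm γ, ← smul_neg, smul_smul, he, one_smul, neg_smul]
    rw [h4]
    simp only [hQ, Pi.smul_apply]
    module
  have hQc : Continuous Q := continuous_iff_continuousAt.2 fun u => (hQd u).continuousAt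
  have hcont : Continuous fun u => -γ • (Q u + noise A W t u ω) := by fun_prop
  have hint := intervalIntegral.integral_eq_sub_of_hasDerivAt (a := t) (b := s)
    (fun u _ => hQd u) (hcont.intervalIntegrable _ _)
  have hQt : Q t = z := by simp [hQ]
  rw [hQt, intervalIntegral.integral_smul] at hint
  have hc : ∫ u in t..s, ou γ A W t z u ω = ∫ u in t..s, (Q u + noise A W t u ω) := by
    refine intervalIntegral.integral_congr fun u hu => ?_
    rw [uIcc_of_le hs] at hu
    exact hou u hu.1
  rw [hou s hs, hc]
  change _ = _ + noise A W t s ω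
  have : Q s = z + -γ • ∫ u in t..s, (Q u + noise A W t u ω) := by
    rw [hint]; abel
  rw [this, neg_smul, ← sub_eq_add_neg]

end Noise

/-- The space of continuous real paths, with the `σ`-algebra generated by the coordinates. -/
abbrev PathSpace := {p : ℝ → ℝ // Continuous p}

/-- The coordinate process on the path space. -/
def coord (s : ℝ) (p : PathSpace) : ℝ := p.1 s

/-! ### The system and Problem 1 -/

/-- The data of the planning problem: generators, horizon `T`, feasible sets `G i` for the base
case `i = 0` and the contingencies `i = 1,…,nc` with weights `q i`, nodal costs `c` of unserved
load, production cost `CG`, forecast `m`, mean reversion `γ` and volatility matrix `σ`. -/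
structure System (nG nL nc : ℕ) extends Generators nG where
  T : ℝ
  G : Fin (nc + 1) → Set ((Fin nG → ℝ) × Load nL)
  q : Fin (nc + 1) → ℝ
  c : Fin nL → ℝ
  CG : (Fin nG → ℝ) → ℝ
  m : ℝ → Load nL
  γ : ℝ
  σ : Matrix (Fin nL) (Fin nL) ℝ
  T_nonneg : 0 ≤ T
  G_nonneg : ∀ i, ∀ g ∈ G i, ∀ j, 0 ≤ g.2 j
  G_convex : ∀ i, Convex ℝ (G i)
  G_compact : ∀ i, IsCompact (G i)
  G_shed : ∀ i, ∀ p ∈ toGenerators.DG, ∀ d : Load nL, (∀ j, 0 ≤ d j) →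
    ∃ z : Load nL, (∀ j, 0 ≤ z j) ∧ (p, d - z) ∈ G i
  G_interior : ∀ i, ∀ p ∈ toGenerators.DG, ∃ d, (p, d) ∈ interior (G i)
  G_oversat : ∀ i, ∀ p d, (p, d) ∈ G i → ∀ d' : Load nL, (∀ j, 0 ≤ d' j ∧ d' j ≤ d j) →
    (p, d') ∈ G i
  q_nonneg : ∀ i, 0 ≤ q i
  c_pos : ∀ j, 0 < c j
  CG_cont : ContinuousOn CG toGenerators.DG
  m_nonneg : ∀ s ∈ Icc 0 T, ∀ j, 0 ≤ m s j
  m_lipschitz : ∃ C > 0, ∀ s ∈ Icc 0 T, ∀ s' ∈ Icc 0 T, ‖m s - m s'‖ ≤ C * |s - s'|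
  γ_nonneg : 0 ≤ γ
  σ_nonsingular : IsUnit σ.det

namespace System

variable {nG nL nc : ℕ} (S : System nG nL nc)

/-- The map `x ↦ σ x`. -/
def sig : Load nL →L[ℝ] Load nL := Matrix.toEuclideanCLM (𝕜 := ℝ) S.σ

/-- The map `x ↦ σ⁻¹ x`. -/
def sigInv : Load nL →L[ℝ] Load nL := Matrix.toEuclideanCLM (𝕜 := ℝ) S.σ⁻¹

/-- `cᵀ z`. -/
def costOf (z : Load nL) : ℝ := ∑ j, S.c j * z j

/-- The componentwise positive part. -/
def posPart (x : Load nL) : Load nL := WithLp.toLp 2 fun j => max (x j) 0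

/-- `cᵀ z_i^*(p_G,p_D)`: the minimal cost of a load disruption `z ≥ 0` that makes
`(p_G, p_D - z)` feasible in configuration `i`. -/
def shedCost (i : Fin (nc + 1)) (p : Fin nG → ℝ) (d : Load nL) : ℝ :=
  sInf {κ | ∃ z : Load nL, (∀ j, 0 ≤ z j) ∧ (p, d - z) ∈ S.G i ∧ κ = S.costOf z}

/-- The running cost `f(x,a,r)`. -/
def f (x : Load nL) (a : S.Mode) (r : Fin nG → ℝ) : ℝ :=
  S.CG (S.zeta a r) + ∑ i, S.q i * S.shedCost i (S.zeta a r) (posPart x)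

section Problem1

variable {Ω : Type*}

/-- The demand process `X^{t,x}`, started from `x` at time `t`. -/
def X (W : ℝ≥0 → Ω → Load nL) (t : ℝ) (x : Load nL) (s : ℝ) (ω : Ω) : Load nL :=
  S.m s + ou S.γ S.sig W t (x - S.m t) s ω

/-- The set `𝒱_{t,a,r}` of controls of Problem 1, started afresh at time `t` with demand `x`. -/
def Controls (W : ℝ≥0 → Ω → Load nL) (t : ℝ) (x : Load nL) (a : S.Mode) (r : Fin nG → ℝ) :
    Set (Ω → S.Requests) :=
  {v | IsAdaptedControl S.toGenerators (S.X W t x) v ∧ ∀ ω, S.PathAdmissible S.T t a r (v ω)}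

/-- The cost-to-go `J(t,x,a,r;v)`. -/
def J [MeasurableSpace Ω] (P : Measure Ω) (W : ℝ≥0 → Ω → Load nL) (t : ℝ) (x : Load nL)
    (a : S.Mode) (r : Fin nG → ℝ) (v : Ω → S.Requests) : ℝ :=
  ∫ ω, ((∫ s in t..S.T, S.f (S.X W t x s ω) (S.alpha t a r (v ω) s) (S.xi t a r (v ω) s)) +
    S.switchCost S.T t (v ω)) ∂P

/-- The value function of Problem 1. -/
def V [MeasurableSpace Ω] (P : Measure Ω) (W : ℝ≥0 → Ω → Load nL) (t : ℝ) (x : Load nL)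
    (a : S.Mode) (r : Fin nG → ℝ) : ℝ :=
  sInf (S.J P W t x a r '' S.Controls W t x a r)

end Problem1

/-! ### Problem UB -/

/-- The distance `min {‖σ⁻¹(p_D - m(t))‖ : (p_G,p_D) ∈ ∂G_i}`. -/
def dTilde (i : Fin (nc + 1)) (t : ℝ) (p : Fin nG → ℝ) : ℝ :=
  sInf {y | ∃ d : Load nL, (p, d) ∈ frontier (S.G i) ∧ y = ‖S.sigInv (d - S.m t)‖}

open Classical in
/-- The signed distance `d_i(t,p_G)`. -/
def d (i : Fin (nc + 1)) (t : ℝ) (p : Fin nG → ℝ) : ℝ :=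
  if (p, S.m t) ∈ S.G i then S.dTilde i t p else -S.dTilde i t p

/-- `max_{‖ξ‖ = 1} cᵀ(σ ξ)^+`. -/
def kappa : ℝ := sSup {y | ∃ ξ : Load nL, ‖ξ‖ = 1 ∧ y = S.costOf (posPart (S.sig ξ))}

/-- The bound `C^B_i(t,p_G,y)` on the cost of load disruption. -/
def CB (i : Fin (nc + 1)) (t : ℝ) (p : Fin nG → ℝ) (y : ℝ) : ℝ :=
  max 0 (y - S.d i t p) * S.kappa

/-- `f^B_1(t,p_G,y)`. -/
def fB1 (t : ℝ) (p : Fin nG → ℝ) (y : ℝ) : ℝ := S.CG p + ∑ i, S.q i * S.CB i t p y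

/-- `f^B_2(t,y,a,w)`, the maximum of `f^B_1(t,·,y)` over `D_G(a,w)`. -/
def fB2 (t y : ℝ) (a : S.Mode) (w : ℝ) : ℝ := sSup ((fun p => S.fB1 t p y) '' S.DGw a w)

section ProblemUB

variable {Ω : Type*}

/-- A path of `X^{B,t,y} = ‖σ⁻¹ Z‖`, where `Z` is the forecast error started at time `t` from a
point with `‖σ⁻¹ Z_t‖ = y`. The law of this process does not depend on which such point is used,
here `σ (y e)` with `e` the first unit vector. -/
def XBpath [NeZero nL] {W : ℝ≥0 → Ω → Load nL} (hW : ∀ ω, Continuous fun t => W t ω) (t y : ℝ)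
    (ω : Ω) : PathSpace :=
  ⟨fun s => ‖S.sigInv (ou S.γ S.sig W t (S.sig (y • EuclideanSpace.single 0 1)) s ω)‖,
    (S.sigInv.continuous.comp (ou_continuous S.γ S.sig (hW ω) t _)).norm⟩

/-- The law of the one-dimensional process `X^{B,t,y}` on path space. -/
def lawB [NeZero nL] [MeasurableSpace Ω] (P : Measure Ω) {W : ℝ≥0 → Ω → Load nL}
    (hW : ∀ ω, Continuous fun t => W t ω) (t y : ℝ) : Measure PathSpace :=
  P.map (S.XBpath hW t y)

/-- The set `𝒱^B_{t,a,w}`: controls adapted to the filtration generated by the one-dimensional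
process (on its path space) that make no requests during transitions. -/
def ControlsB (t : ℝ) (a : S.Mode) (w : ℝ) : Set (PathSpace → S.Requests) :=
  {v | IsAdaptedControl S.toGenerators coord v ∧ ∀ p, S.PathAdmissibleB S.T t a w (v p)}

/-- The cost-to-go `J^B(t,y,a,w;v)`. -/
def JB [NeZero nL] [MeasurableSpace Ω] (P : Measure Ω) {W : ℝ≥0 → Ω → Load nL}
    (hW : ∀ ω, Continuous fun t => W t ω) (t y : ℝ) (a : S.Mode) (w : ℝ)
    (v : PathSpace → S.Requests) : ℝ :=
  ∫ p, ((∫ s in t..S.T, S.fB2 s (coord s p) (S.alphaB t a w (v p) s) (S.rho t w (v p) s)) +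
    S.switchCost S.T t (v p)) ∂(S.lawB P hW t y)

/-- The value function of Problem UB. -/
def VUB [NeZero nL] [MeasurableSpace Ω] (P : Measure Ω) {W : ℝ≥0 → Ω → Load nL}
    (hW : ∀ ω, Continuous fun t => W t ω) (t y : ℝ) (a : S.Mode) (w : ℝ) : ℝ :=
  sInf (S.JB P hW t y a w '' S.ControlsB t a w)

end ProblemUB

end System

end PowerOps

end

open MeasureTheory ProbabilityTheory Set Filter Topology
open scoped NNReal

noncomputable section

/-! ### Last entries and maxima of lists -/

namespace List

/-! The infimum defining `V` is bounded by converting each control of Problem UB into a control of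
Problem 1 that costs no more. A control `v` of Problem UB is a functional of one-dimensional paths;
it is applied to the path `φ(ω)` given by `s ↦ ‖σ⁻¹(X_s - m(s))‖`. Then `v ∘ φ` is adapted to `X`,
because the value of this path at time `s` is a measurable function of `X_s`
(`IsAdaptedControl.comp`). It also respects the switching rules: transitions of Problem UB last at
least as long as the real ones, so a generator counted there as being at a set-point really is at
that set-point (`alpha_eq_of_alphaB_eq`).

The running costs compare pointwise, by two facts. First, the real production lies in `D_G(α^B, ϱ)`:
the remaining times of the real transitions, cut off at zero, have maximum `ϱ`, and the closure in
`D_G` accounts for transitions that are already over (`zeta_mem_DGw_of_pathAdmissibleB`). Second,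
each disruption cost is at most `κ (y - d_i)^+` with `y = ‖σ⁻¹(x - m)‖`, by shedding load down to a
feasible point, often a boundary point, and using positive homogeneity of `z ↦ cᵀ(σz)^+`
(`shedCost_le_CB`). Hence `f ≤ f_1^B ≤ f_2^B`, while the switching costs agree. Finally `φ` has the
law used in Problem UB, because `σ⁻¹Z` is an Ornstein–Uhlenbeck process with unit volatility and
Brownian motion is rotation invariant (`map_normPath_eq`, `lawB_eq`).

Most of the remaining work justifies the integrals, since an undefined integral or infimum defaults
to `0`. Joint measurability of `f_2^B` comes from lower semicontinuity of the signed distance and a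
theorem on suprema over closed fibres in a compact set. Mode processes are measurable because
request lists decompose into countably many cases. Integrability comes from linear growth of the
costs and from the separation of requests, which bounds the number of switches. -/

lemma getLast?_filterMap_eq_some_iff {α β : Type*} (f : α → Option β) (l : List α) (b : β) :
    (l.filterMap f).getLast? = some b ↔
      ∃ (j : ℕ) (a : α), l[j]? = some a ∧ f a = some b ∧
        ∀ j' > j, ∀ a', l[j']? = some a' → f a' = none := by
  induction l with
  | nil => simp
  | cons x l ih =>
    -- Either the head is the last hit, or the last hit lies in the tail with its index shifted by
    -- one.
    have key : (∃ (j : ℕ) (a : α), (x :: l)[j]? = some a ∧ f a = some b ∧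
        ∀ j' > j, ∀ a', (x :: l)[j']? = some a' → f a' = none) ↔
        (f x = some b ∧ ∀ a' ∈ l, f a' = none) ∨ (l.filterMap f).getLast? = some b := by
      rw [ih]
      constructor
      · rintro ⟨j, a, h1, h2, h3⟩
        cases j with
        | zero =>
          simp only [getElem?_cons_zero, Option.some.injEq] at h1
          subst h1
          refine Or.inl ⟨h2, fun a' ha' => ?_⟩
          obtain ⟨i, hi⟩ := List.mem_iff_getElem?.1 ha'
          exact h3 (i + 1) (by omega) a' (by simpa using hi)
        | succ j =>
          refine Or.inr ⟨j, a, by simpa using h1, h2, fun j' hj' a' ha' => ?_⟩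
          exact h3 (j' + 1) (by omega) a' (by simpa using ha')
      · rintro (⟨h1, h2⟩ | ⟨j, a, h1, h2, h3⟩)
        · refine ⟨0, x, by simp, h1, fun j' hj' a' ha' => ?_⟩
          obtain ⟨i, rfl⟩ : ∃ i, j' = i + 1 := ⟨j' - 1, by omega⟩
          exact h2 a' (List.mem_iff_getElem?.2 ⟨i, by simpa using ha'⟩)
        · refine ⟨j + 1, a, by simpa using h1, h2, fun j' hj' a' ha' => ?_⟩
          obtain ⟨i, rfl⟩ : ∃ i, j' = i + 1 := ⟨j' - 1, by omega⟩
          exact h3 i (by omega) a' (by simpa using ha')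
    rw [key]
    rcases hx : f x with _ | y
    · simp [List.filterMap_cons_none hx]
    · rw [List.filterMap_cons_some hx]
      rcases hl : l.filterMap f with _ | ⟨z, zs⟩
      · have : ∀ a' ∈ l, f a' = none := by simpa [List.filterMap_eq_nil_iff] using hl
        simp
        tauto
      · have : ¬ ∀ a' ∈ l, f a' = none := by
          rw [← List.filterMap_eq_nil_iff, hl]; simp
        rw [List.getLast?_cons_cons]
        tauto

lemma getLast?_filter_eq_some_iff {α : Type*} (q : α → Bool) (l : List α) (a : α) :
    (l.filter q).getLast? = some a ↔
      ∃ j : ℕ, l[j]? = some a ∧ q a = true ∧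
        ∀ j' > j, ∀ a', l[j']? = some a' → ¬ q a' = true := by
  have : l.filter q = l.filterMap (Option.guard q) := by rw [List.filterMap_eq_filter]
  rw [this, getLast?_filterMap_eq_some_iff]
  simp only [Option.guard_eq_some_iff, Option.guard_eq_none_iff]
  constructor
  · rintro ⟨j, b, h1, ⟨rfl, h2⟩, h3⟩
    exact ⟨j, h1, h2, fun j' hj' a' ha' => by simpa using h3 j' hj' a' ha'⟩
  · rintro ⟨j, h1, h2, h3⟩
    exact ⟨j, a, h1, ⟨rfl, h2⟩, fun j' hj' a' ha' => by simpa using h3 j' hj' a' ha'⟩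

lemma le_foldr_max {l : List ℝ} {x : ℝ} (h : x ∈ l) : x ≤ l.foldr max 0 := by
  induction l with
  | nil => simp at h
  | cons y l ih =>
    rcases List.mem_cons.1 h with rfl | h
    · exact le_max_left _ _
    · exact (ih h).trans (le_max_right _ _)

lemma lt_foldr_max_iff {l : List ℝ} {x : ℝ} : x < l.foldr max 0 ↔ x < 0 ∨ ∃ y ∈ l, x < y := by
  induction l with
  | nil => simp
  | cons y l ih =>
    simp only [foldr_cons, lt_max_iff, ih, mem_cons, exists_eq_or_imp]
    tauto

end List

/-! ### Mode processes of the two problems and the sets `D_G(a,w)` -/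

namespace PowerOps

namespace Generators

variable {nG : ℕ} (S : Generators nG)

/-- Describing the last request by its index removes the dependent cast and leaves countably many
conditions on single entries, as needed for measurability. -/
lemma lastTo_eq_some_iff (ℓ : S.Requests) (k : Fin nG) (s τ : ℝ) (e : S.Edge k) :
    S.lastTo ℓ k s = some (τ, e) ↔
      ∃ j : ℕ, ℓ[j]? = some (τ, ⟨k, e⟩) ∧ τ ≤ s ∧
        ∀ j' > j, ∀ p, ℓ[j']? = some p → p.2.1 = k → ¬ p.1 ≤ s := by
  unfold lastTo
  rw [List.getLast?_filterMap_eq_some_iff]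
  constructor
  · rintro ⟨j, ⟨τ', ⟨k', e'⟩⟩, h1, h2, h3⟩
    by_cases hk : k' = k
    · subst hk
      by_cases hs : τ' ≤ s
      · simp only [↓reduceDIte, hs, ↓reduceIte, Option.some.injEq, Prod.mk.injEq] at h2
        obtain ⟨rfl, rfl⟩ := h2
        refine ⟨j, h1, hs, fun j' hj' p hp hpk hps => ?_⟩
        have := h3 j' hj' p hp
        simp [hpk, hps] at this
      · simp [hs] at h2
    · simp [hk] at h2
  · rintro ⟨j, h1, h2, h3⟩
    refine ⟨j, _, h1, by simp [h2], fun j' hj' p hp => ?_⟩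
    by_cases hk : p.2.1 = k
    · simp [hk, h3 j' hj' p hp hk]
    · simp [hk]

lemma lastTo_eq_none_iff (ℓ : S.Requests) (k : Fin nG) (s : ℝ) :
    S.lastTo ℓ k s = none ↔ ∀ p ∈ ℓ, p.2.1 = k → ¬ p.1 ≤ s := by
  unfold lastTo
  rw [List.getLast?_eq_none_iff, List.filterMap_eq_nil_iff]
  refine forall₂_congr fun p _ => ?_
  by_cases hk : p.2.1 = k <;> simp [hk]

lemma lastTo_mem {ℓ : S.Requests} {k : Fin nG} {s τ : ℝ} {e : S.Edge k}
    (h : S.lastTo ℓ k s = some (τ, e)) : (τ, (⟨k, e⟩ : S.Request)) ∈ ℓ ∧ τ ≤ s := by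
  obtain ⟨j, h1, h2, -⟩ := (S.lastTo_eq_some_iff ..).1 h
  exact ⟨List.mem_iff_getElem?.2 ⟨j, h1⟩, h2⟩

lemma delay_le_batchDelay {ℓ : S.Requests} {p : ℝ × S.Request} (h : p ∈ ℓ) :
    S.δ p.2.1 p.2.2 ≤ S.batchDelay ℓ p.1 :=
  List.le_foldr_max (List.mem_map.2 ⟨p, by simpa using h, rfl⟩)

lemma lt_batchDelay_iff {ℓ : S.Requests} {τ x : ℝ} :
    x < S.batchDelay ℓ τ ↔ x < 0 ∨ ∃ p ∈ ℓ, p.1 = τ ∧ x < S.δ p.2.1 p.2.2 := by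
  unfold batchDelay
  rw [List.lt_foldr_max_iff]
  simp only [List.mem_map, List.mem_filter, decide_eq_true_eq, and_assoc]
  refine or_congr_right ⟨?_, ?_⟩
  · rintro ⟨y, ⟨p, h1, h2, rfl⟩, h3⟩
    exact ⟨p, h1, h2, h3⟩
  · rintro ⟨p, h1, h2, h3⟩
    exact ⟨_, ⟨p, h1, h2, rfl⟩, h3⟩

lemma sub_nonneg_of_mem_H {a : S.Mode} {r : Fin nG → ℝ} (hr : r ∈ S.H a) (k : Fin nG) :
    0 ≤ S.modeDelay k (a k) - r k := by
  have := hr k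
  rcases h : a k with l | e <;> simp only [h] at this
  · simp [modeDelay, this]
  · simp [modeDelay, this.2.le]

lemma psi_nonneg {a : S.Mode} {r : Fin nG → ℝ} (hr : r ∈ S.H a) : 0 ≤ S.psi a r :=
  Real.iSup_nonneg (S.sub_nonneg_of_mem_H hr)

lemma le_psi (a : S.Mode) (r : Fin nG → ℝ) (k : Fin nG) : S.modeDelay k (a k) - r k ≤ S.psi a r :=
  le_ciSup (f := fun k => S.modeDelay k (a k) - r k) (Set.finite_range _).bddAbove k

lemma psi_eq {a : S.Mode} {r : Fin nG → ℝ} {w : ℝ}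
    (hle : ∀ k, S.modeDelay k (a k) - r k ≤ w) (hex : ∃ k, S.modeDelay k (a k) - r k = w) :
    S.psi a r = w := by
  obtain ⟨k, hk⟩ := hex
  have : Nonempty (Fin nG) := ⟨k⟩
  exact le_antisymm (ciSup_le hle) (hk ▸ S.le_psi a r k)

/-- At set-points only, the time to completion vanishes. -/
lemma psi_eq_zero {a : S.Mode} {r : Fin nG → ℝ} (h : ∀ k, S.modeDelay k (a k) - r k = 0) :
    S.psi a r = 0 := by
  unfold psi
  simp only [h]
  exact Real.iSup_const_zero

/-- Problem UB ends transitions no earlier than Problem 1: a batch delay dominates each of its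
delays, and `ψ(a,r)` dominates each initial remaining time. The target set-points are the same. -/
lemma alpha_eq_of_alphaB_eq {t : ℝ} {a : S.Mode} {r : Fin nG → ℝ} {ℓ : S.Requests} {s : ℝ}
    {k : Fin nG} {l : Fin (S.top k + 1)} (h : S.alphaB t a (S.psi a r) ℓ s k = Sum.inl l) :
    S.alpha t a r ℓ s k = Sum.inl l := by
  unfold alphaB at h
  unfold alpha
  rcases hl : S.lastTo ℓ k s with _ | ⟨τ, e⟩
  · simp only [hl] at h ⊢
    have hψ := S.le_psi a r k
    rcases ha : a k with l' | e
    · simpa [ha] using h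
    · simp only [ha, modeDelay] at h hψ ⊢
      split_ifs at h with hs
      rw [if_neg (by linarith), h]
  · simp only [hl] at h ⊢
    split_ifs at h with hs
    have := S.delay_le_batchDelay (S.lastTo_mem hl).1
    simp only at this
    rw [if_neg (by linarith), h]

lemma PathAdmissibleB.pathAdmissible {T t : ℝ} {a : S.Mode} {r : Fin nG → ℝ} {ℓ : S.Requests}
    (hr : r ∈ S.H a) (h : S.PathAdmissibleB T t a (S.psi a r) ℓ) :
    S.PathAdmissible T t a r ℓ := by
  obtain ⟨h1, h2, h3, -⟩ := h
  have := S.psi_nonneg hr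
  refine ⟨h1, fun p hp => ⟨by linarith [(h2 p hp).1], (h2 p hp).2⟩, fun p hp => ?_⟩
  exact (h3 p hp).mono fun s hs => S.alpha_eq_of_alphaB_eq hs

lemma xi_mem_H {t : ℝ} {a : S.Mode} {r : Fin nG → ℝ} (hr : r ∈ S.H a) (ℓ : S.Requests) {s : ℝ}
    (hs : t ≤ s) : S.xi t a r ℓ s ∈ S.H (S.alpha t a r ℓ s) := by
  intro k
  have hk := hr k
  unfold xi alpha
  rcases hl : S.lastTo ℓ k s with _ | ⟨τ, e⟩
  · rcases ha : a k with l' | e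
    · simp
    · simp only [ha] at hk ⊢
      by_cases h : s < t - r k + S.δ k e
      · simp only [h, ↓reduceIte]
        constructor <;> linarith [hk.1]
      · simp [h]
  · have := (S.lastTo_mem hl).2
    by_cases h : s < τ + S.δ k e
    · simp only [h, ↓reduceIte]
      constructor <;> linarith
    · simp [h]

lemma θ_mem (k : Fin nG) (l : Fin (S.top k + 1)) :
    S.θ k l ∈ Icc (S.θ k 0) (S.θ k (Fin.last (S.top k))) :=
  ⟨(S.θ_strictMono k).monotone (Fin.zero_le _), (S.θ_strictMono k).monotone (Fin.le_last _)⟩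

/-- By monotonicity the curve stays between its two end values, which are set-points. -/
lemma ramp_mem {k : Fin nG} {e : Fin (S.top k + 1) × Fin (S.top k + 1)} (he : e ∈ S.Λ k) {u : ℝ}
    (hu : u ∈ Icc 0 (S.δ k e)) :
    S.ramp k e u ∈ Icc (S.θ k 0) (S.θ k (Fin.last (S.top k))) := by
  have h0 : (0 : ℝ) ∈ Icc 0 (S.δ k e) := ⟨le_rfl, hu.1.trans hu.2⟩
  have h1 : S.δ k e ∈ Icc 0 (S.δ k e) := ⟨hu.1.trans hu.2, le_rfl⟩
  have e1 := S.θ_mem k e.1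
  have e2 := S.θ_mem k e.2
  rw [← S.ramp_start k e he] at e1
  rw [← S.ramp_end k e he] at e2
  rcases S.ramp_mono k e he with h | h
  · exact ⟨e1.1.trans (h h0 hu hu.1), (h hu h1 hu.2).trans e2.2⟩
  · exact ⟨e2.1.trans (h hu h1 hu.2), (h h0 hu hu.1).trans e1.2⟩

lemma zeta_mem_DG {a : S.Mode} {r : Fin nG → ℝ} (hr : r ∈ S.H a) : S.zeta a r ∈ S.DG := by
  intro k
  have hk := hr k
  unfold zeta
  rcases ha : a k with l | e
  · exact S.θ_mem k l
  · simp only [ha] at hk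
    exact S.ramp_mem e.2 ⟨hk.1, hk.2.le⟩

lemma isCompact_DG : IsCompact S.DG := by
  have : S.DG = Set.univ.pi fun k => Icc (S.θ k 0) (S.θ k (Fin.last (S.top k))) := by
    exact Set.ext fun p => ⟨fun h k _ => h k, fun h k => h k (mem_univ k)⟩
  rw [this]
  exact isCompact_univ_pi fun k => isCompact_Icc

lemma DGw_subset (a : S.Mode) (w : ℝ) : S.DGw a w ⊆ S.DG :=
  closure_minimal (fun _ h => h.1) S.isCompact_DG.isClosed

lemma ramp_continuousOn {k : Fin nG} {e : Fin (S.top k + 1) × Fin (S.top k + 1)}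
    (he : e ∈ S.Λ k) : ContinuousOn (S.ramp k e) (Icc 0 (S.δ k e)) := by
  obtain ⟨C, hC, h⟩ := S.ramp_rate
  refine LipschitzOnWith.continuousOn (K := C.toNNReal) (LipschitzOnWith.of_dist_le_mul ?_)
  intro u hu v hv
  rw [Real.dist_eq, Real.dist_eq, Real.coe_toNNReal _ hC.le]
  exact h k e he u hu v hv

/-- The possible values of the time left in the transition of generator `k` (only `0` at a
set-point), including `0` for a transition that is just over. -/
def remaining (a : S.Mode) (k : Fin nG) : Set ℝ := Icc 0 (S.modeDelay k (a k))

/-- The production in mode `a` when the time left in transition `k` is `u k`. -/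
def output (a : S.Mode) (u : Fin nG → ℝ) : Fin nG → ℝ :=
  S.zeta a fun k => S.modeDelay k (a k) - u k

lemma output_continuousOn (a : S.Mode) :
    ContinuousOn (S.output a) (Set.univ.pi (S.remaining a)) := by
  refine continuousOn_pi.2 fun k => ?_
  unfold output zeta
  rcases ha : a k with l | e
  · exact continuousOn_const
  · simp only [ha, modeDelay]
    refine (S.ramp_continuousOn e.2).comp (by fun_prop) fun u hu => ?_
    have := hu k (mem_univ k)
    simp only [remaining, ha, modeDelay] at this
    exact ⟨by linarith [this.2], by linarith [this.1]⟩

/-- For a positive remaining time, the closure in the definition of `D_G(a,w)` amounts to allowing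
for transitions that are already over. -/
lemma output_mem_DGw {a : S.Mode} {u : Fin nG → ℝ} {w : ℝ} (hu : u ∈ Set.univ.pi (S.remaining a))
    (hle : ∀ k, u k ≤ w) (hex : ∃ k, u k = w) (hw : 0 < w) : S.output a u ∈ S.DGw a w := by
  classical
  -- Points of `H(a)` have strictly positive time left in every transition. Remaining times are
  -- therefore raised to at least `ε`, which is then sent to `0`; set-points keep the value `0`.
  set N : Fin nG → ℝ → ℝ := fun k ε => if S.modeDelay k (a k) = 0 then 0 else max (u k) ε with hN
  have hδ : ∀ k, 0 ≤ S.modeDelay k (a k) := fun k => (hu k (mem_univ k)).1.trans (hu k (mem_univ k)).2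
  have hlim : Tendsto (fun ε k => N k ε) (𝓝[>] 0) (𝓝[Set.univ.pi (S.remaining a)] u) := by
    refine tendsto_nhdsWithin_iff.2 ⟨tendsto_pi_nhds.2 fun k => ?_, ?_⟩
    · have huk := hu k (mem_univ k)
      simp only [hN]
      split_ifs with h
      · have : u k = 0 := le_antisymm (h ▸ huk.2) huk.1
        rw [this]; exact tendsto_const_nhds
      · have : Tendsto (fun ε : ℝ => max (u k) ε) (𝓝 0) (𝓝 (max (u k) 0)) :=
          (Continuous.tendsto (by fun_prop) 0)
        rw [max_eq_left huk.1] at this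
        exact this.mono_left nhdsWithin_le_nhds
    · have : ∀ᶠ ε : ℝ in 𝓝[>] 0, ∀ k, N k ε ∈ S.remaining a k := by
        rw [eventually_all]
        intro k
        have huk := hu k (mem_univ k)
        by_cases h : S.modeDelay k (a k) = 0
        · simp [hN, h, remaining]
        · have h' : 0 < S.modeDelay k (a k) := lt_of_le_of_ne (hδ k) (Ne.symm h)
          filter_upwards [Ioo_mem_nhdsGT h'] with ε hε
          simp only [hN, if_neg h]
          exact ⟨huk.1.trans (le_max_left _ _), max_le huk.2 hε.2.le⟩
      filter_upwards [this] with ε hε k _ using hε k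
  have hout := ((S.output_continuousOn a) u hu).tendsto.comp hlim
  refine mem_closure_of_tendsto hout ?_
  -- With `ε` below every positive delay the progression stays nonnegative; `ε < w` below ensures
  -- that the largest remaining time is still `w`.
  have hev : ∀ᶠ ε : ℝ in 𝓝[>] 0, ∀ k, S.modeDelay k (a k) ≠ 0 → ε < S.modeDelay k (a k) := by
    rw [eventually_all]
    intro k
    by_cases h : S.modeDelay k (a k) = 0
    · simp [h]
    · have h' : 0 < S.modeDelay k (a k) := lt_of_le_of_ne (hδ k) (Ne.symm h)
      filter_upwards [Ioo_mem_nhdsGT h'] with ε hε _ using hε.2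
  filter_upwards [hev, Ioo_mem_nhdsGT hw] with ε h1 h2
  have hH : (fun k => S.modeDelay k (a k) - N k ε) ∈ S.H a := by
    intro k
    have huk := hu k (mem_univ k)
    have h1k := h1 k
    rcases ha : a k with l | e
    · simp [hN, ha, modeDelay]
    · have := S.δ_pos k e e.2
      simp only [remaining, ha, modeDelay] at huk h1k
      simp only [hN, ha, modeDelay, this.ne', if_false]
      have := h1k this.ne'
      refine ⟨?_, ?_⟩
      · linarith [max_le huk.2 this.le]
      · linarith [le_max_right (u k) ε, h2.1]
  refine ⟨S.zeta_mem_DG hH, _, hH, ?_, rfl⟩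
  apply S.psi_eq
  · intro k
    simp only [hN, sub_sub_cancel]
    split_ifs
    · exact hw.le
    · exact max_le (hle k) h2.2.le
  · obtain ⟨k, hk⟩ := hex
    refine ⟨k, ?_⟩
    have huk := hu k (mem_univ k)
    have : S.modeDelay k (a k) ≠ 0 := by
      intro h
      rw [remaining, h, hk] at huk
      linarith [huk.2]
    simp only [hN, sub_sub_cancel, if_neg this, hk]
    exact max_eq_left h2.2.le

lemma zeta_mem_DGw {a : S.Mode} {r : Fin nG → ℝ} (hr : r ∈ S.H a) {w : ℝ} (hw : S.psi a r = w) :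
    S.zeta a r ∈ S.DGw a w :=
  subset_closure ⟨S.zeta_mem_DG hr, r, hr, hw, rfl⟩

end Generators
end PowerOps

/-! ### The real production lies in `D_G(α^B, ϱ)` -/

namespace List

lemma Pairwise.rel_of_getElem? {α : Type*} {R : α → α → Prop} {l : List α} (h : l.Pairwise R)
    {i j : ℕ} {x y : α} (hi : l[i]? = some x) (hj : l[j]? = some y) (hij : i < j) : R x y := by
  obtain ⟨hi', rfl⟩ := List.getElem?_eq_some_iff.1 hi
  obtain ⟨hj', rfl⟩ := List.getElem?_eq_some_iff.1 hj
  exact List.pairwise_iff_getElem.1 h i j hi' hj' hij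

lemma foldr_max_mem {l : List ℝ} (h : 0 < l.foldr max 0) : l.foldr max 0 ∈ l := by
  induction l with
  | nil => simp at h
  | cons y l ih =>
    rw [List.foldr_cons] at h ⊢
    rcases le_total (l.foldr max 0) y with hy | hy
    · rw [max_eq_left hy]; simp
    · rw [max_eq_right hy] at h ⊢
      exact List.mem_cons_of_mem _ (ih h)

end List

namespace PowerOps

namespace Generators

variable {nG : ℕ} (S : Generators nG)

lemma exists_eq_batchDelay {ℓ : S.Requests} {τ : ℝ} (h : 0 < S.batchDelay ℓ τ) :
    ∃ k, ∃ e : S.Edge k, (τ, (⟨k, e⟩ : S.Request)) ∈ ℓ ∧ S.δ k e = S.batchDelay ℓ τ := by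
  have := List.foldr_max_mem h
  obtain ⟨⟨τ', k, e⟩, hp, hp'⟩ := List.mem_map.1 this
  simp only [List.mem_filter, decide_eq_true_eq] at hp
  obtain ⟨hp1, rfl⟩ := hp
  exact ⟨k, e, hp1, hp'⟩

/-- Times are nondecreasing along the list, so last in the list means latest in time. The Boolean
test is left abstract so that any form of the filter predicate is allowed. -/
lemma le_of_last {ℓ : S.Requests} (ho : S.Ordered ℓ) {s : ℝ} {p : ℝ × S.Request} {q : ℝ × S.Request → Bool}
    (hq : ∀ p, q p = true ↔ p.1 ≤ s)
    (h : (ℓ.filter q).getLast? = some p) :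
    p ∈ ℓ ∧ p.1 ≤ s ∧ ∀ p' ∈ ℓ, p'.1 ≤ s → p'.1 ≤ p.1 := by
  obtain ⟨j, h1, h2, h3⟩ := (List.getLast?_filter_eq_some_iff ..).1 h
  refine ⟨List.mem_iff_getElem?.2 ⟨j, h1⟩, (hq _).1 h2, fun p' hp' hs => ?_⟩
  obtain ⟨i, hi⟩ := List.mem_iff_getElem?.1 hp'
  rcases lt_trichotomy i j with hij | rfl | hij
  · exact (ho.rel_of_getElem? hi h1 hij).1
  · rw [h1] at hi
    exact (Option.some.inj hi) ▸ le_rfl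
  · exact absurd ((hq _).2 hs) (h3 i hij p' hi)

/-- A later list entry for the same generator would have a strictly larger time, against the
maximality of `τ`. -/
lemma lastTo_eq_of_mem {ℓ : S.Requests} (ho : S.Ordered ℓ) {k : Fin nG} {e : S.Edge k} {τ s : ℝ}
    (hm : (τ, (⟨k, e⟩ : S.Request)) ∈ ℓ) (hs : τ ≤ s) (hlast : ∀ p ∈ ℓ, p.1 ≤ s → p.1 ≤ τ) :
    S.lastTo ℓ k s = some (τ, e) := by
  obtain ⟨i, hi⟩ := List.mem_iff_getElem?.1 hm
  refine (S.lastTo_eq_some_iff ..).2 ⟨i, hi, hs, fun j' hj' p hp hpk hps => ?_⟩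
  have h1 := (ho.rel_of_getElem? hi hp hj').2 hpk.symm
  have h2 := hlast p (List.mem_iff_getElem?.2 ⟨j', hp⟩) hps
  exact absurd h1 (not_lt.2 h2)

/-- When Problem UB sees only set-points, the two modes coincide and all progressions vanish, so `ψ
= 0`. -/
lemma zeta_mem_DGw_of_setpoints {t : ℝ} {a : S.Mode} {r : Fin nG → ℝ} (hr : r ∈ S.H a)
    {ℓ : S.Requests} {s : ℝ} (hs : t ≤ s)
    (h : ∀ k, ∃ l, S.alphaB t a (S.psi a r) ℓ s k = Sum.inl l) :
    S.zeta (S.alpha t a r ℓ s) (S.xi t a r ℓ s) ∈ S.DGw (S.alphaB t a (S.psi a r) ℓ s) 0 := by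
  have hα : S.alpha t a r ℓ s = S.alphaB t a (S.psi a r) ℓ s := by
    funext k
    obtain ⟨l, hl⟩ := h k
    rw [hl, S.alpha_eq_of_alphaB_eq hl]
  have hH := S.xi_mem_H hr ℓ hs
  rw [hα] at hH ⊢
  refine S.zeta_mem_DGw hH (S.psi_eq_zero fun k => ?_)
  obtain ⟨l, hl⟩ := h k
  have := hH k
  simp only [hl] at this
  simp [hl, modeDelay, this]

/-- The production in Problem 1 under a control of Problem UB is among those considered there. -/
lemma zeta_mem_DGw_of_pathAdmissibleB {T t : ℝ} {a : S.Mode} {r : Fin nG → ℝ} (hr : r ∈ S.H a)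
    {ℓ : S.Requests} (h : S.PathAdmissibleB T t a (S.psi a r) ℓ) {s : ℝ} (hs : t ≤ s) :
    S.zeta (S.alpha t a r ℓ s) (S.xi t a r ℓ s) ∈
      S.DGw (S.alphaB t a (S.psi a r) ℓ s) (S.rho t (S.psi a r) ℓ s) := by
  classical
  obtain ⟨ho, hT, -, hsep⟩ := h
  set w := S.psi a r with hw
  -- Only one batch matters at time `s`: the initial transitions if there has been no request, and
  -- otherwise the batch of the latest request `p`.
  rcases hl : (ℓ.filter fun p => p.1 ≤ s).getLast? with _ | p
  · have hrho : S.rho t w ℓ s = max 0 (w - (s - t)) := by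
      have hl' := hl
      simp only [rho]
      convert add_zero _
      split
      · rename_i heq; rw [hl'] at heq; cases heq
      · rfl
    have hnone : ∀ k, S.lastTo ℓ k s = none := by
      intro k
      refine (S.lastTo_eq_none_iff ..).2 fun p hp _ hps => ?_
      rw [List.getLast?_eq_none_iff, List.filter_eq_nil_iff] at hl
      exact hl p hp (by simpa using hps)
    by_cases hsw : s < t + w
    · have hB : S.alphaB t a w ℓ s = a := by
        funext k
        simp only [alphaB, hnone k, hsw, if_true]
        rcases a k <;> rfl
      rw [hrho, hB, max_eq_right (by linarith)]
      -- A real transition that is over sits at the end of its curve, which is remaining time `0` in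
      -- the mode still shown by Problem UB.
      have hout : S.zeta (S.alpha t a r ℓ s) (S.xi t a r ℓ s) =
          S.output a fun k => max 0 (S.modeDelay k (a k) - r k - (s - t)) := by
        funext k
        simp only [zeta, output, alpha, xi, hnone k]
        rcases ha : a k with l | e
        · rfl
        · simp only [modeDelay]
          split_ifs with hc
          · simp only
            rw [max_eq_right (by linarith)]
            congr 1; ring
          · simp only
            rw [max_eq_left (by linarith), sub_zero, S.ramp_end k e e.2]
      rw [hout]
      have hr0 : ∀ k, 0 ≤ r k := by
        intro k
        have := hr k
        rcases ha : a k with l | e <;> simp only [ha] at this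
        · exact this.ge
        · exact this.1
      refine S.output_mem_DGw (fun k _ => ⟨le_max_left _ _, ?_⟩) (fun k => ?_) ?_ (by linarith)
      · have := S.sub_nonneg_of_mem_H hr k
        exact max_le (by linarith [hr0 k]) (by linarith [hr0 k])
      · exact max_le (by linarith) (by linarith [S.le_psi a r k])
      -- The maximum is attained by some generator; with no generators `w = 0`, which contradicts `t
      -- ≤ s < t + w`.
      · have hne : Nonempty (Fin nG) := by
          by_contra hne
          rw [not_nonempty_iff] at hne
          have : w = 0 := by rw [hw, psi, Real.iSup_of_isEmpty]
          linarith
        obtain ⟨k, hk⟩ := exists_eq_ciSup_of_finite (f := fun k => S.modeDelay k (a k) - r k)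
        refine ⟨k, ?_⟩
        have hk' : S.modeDelay k (a k) - r k = w := hk
        rw [hk', max_eq_right (by linarith)]
    · rw [hrho, max_eq_left (by linarith)]
      refine S.zeta_mem_DGw_of_setpoints hr hs fun k => ?_
      simp only [alphaB, hnone k, ← hw, hsw, if_false]
      rcases a k with l | e
      · exact ⟨l, rfl⟩
      · exact ⟨e.1.2, rfl⟩
  · obtain ⟨hp, hps, hlast⟩ := S.le_of_last (s := s) ho (by simp) hl
    have hrho : S.rho t w ℓ s = max 0 (S.batchDelay ℓ p.1 - (s - p.1)) := by
      have hl' := hl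
      have : max 0 (w - (s - t)) = 0 := max_eq_left (by linarith [(hT p hp).1])
      simp only [rho, this, zero_add]
      split
      · rename_i heq; rw [hl'] at heq; cases heq; rfl
      · rename_i heq; rw [hl'] at heq; cases heq
    -- Separation of batches: everything requested before `p.1` is over, in both problems, by time
    -- `p.1`.
    have hold : ∀ k τ (e : S.Edge k), S.lastTo ℓ k s = some (τ, e) → τ ≠ p.1 →
        ¬ s < τ + S.batchDelay ℓ τ := by
      intro k τ e hk hne
      obtain ⟨hm, hτ⟩ := S.lastTo_mem hk
      have hlt := lt_of_le_of_ne (hlast _ hm hτ) hne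
      have := hsep _ hm _ hp hlt
      simp only at this
      linarith
    have hinit : ¬ s < t + w := by linarith [(hT p hp).1]
    by_cases hsd : s < p.1 + S.batchDelay ℓ p.1
    · rw [hrho, max_eq_right (by linarith)]
      -- Only generators of the current batch can have time left.
      set u : Fin nG → ℝ := fun k =>
        match S.lastTo ℓ k s with
        | some (τ, e) => if τ = p.1 then max 0 (S.δ k e - (s - τ)) else 0
        | none => 0 with hu
      have hout : S.zeta (S.alpha t a r ℓ s) (S.xi t a r ℓ s) =
          S.output (S.alphaB t a w ℓ s) u := by
        funext k
        simp only [zeta, output, alpha, xi, alphaB, hu]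
        rcases hk : S.lastTo ℓ k s with _ | ⟨τ, e⟩
        · simp only
          have hψ := S.le_psi a r k
          rcases ha : a k with l | e
          · rfl
          · simp only [ha, modeDelay] at hψ
            simp only [if_neg hinit]
            rw [if_neg (by linarith)]
        · by_cases hτ : τ = p.1
          · subst hτ
            simp only [hsd, if_true, modeDelay]
            split_ifs with hc
            · simp only
              rw [max_eq_right (by linarith)]
              congr 1; ring
            · simp only
              rw [max_eq_left (by linarith), sub_zero, S.ramp_end k e e.2]
          · have h1 := hold k τ e hk hτ
            have h2 := S.delay_le_batchDelay (S.lastTo_mem hk).1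
            simp only at h2
            simp only [h1, if_false]
            rw [if_neg (by linarith)]
      rw [hout]
      refine S.output_mem_DGw (fun k _ => ?_) (fun k => ?_) ?_ (by linarith)
      · simp only [remaining, alphaB, hu]
        rcases hk : S.lastTo ℓ k s with _ | ⟨τ, e⟩
        · simp only
          rcases a k with l | e <;> simp [modeDelay, hinit]
        · by_cases hτ : τ = p.1
          · subst hτ
            simp only [hsd, if_true, modeDelay]
            exact ⟨le_max_left _ _, max_le (S.δ_pos k e e.2).le (by linarith)⟩
          · have h1 := hold k τ e hk hτ
            simp [h1, hτ, modeDelay]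
      · simp only [hu]
        rcases hk : S.lastTo ℓ k s with _ | ⟨τ, e⟩
        · simp only; linarith
        · simp only
          split_ifs with hτ
          · subst hτ
            have h2 := S.delay_le_batchDelay (S.lastTo_mem hk).1
            simp only at h2
            exact max_le (by linarith) (by linarith)
          · linarith
      -- The generator with the largest delay in the batch has exactly `ϱ` left.
      · obtain ⟨k, e, hm, he⟩ := S.exists_eq_batchDelay (ℓ := ℓ) (τ := p.1) (by linarith)
        have hk := S.lastTo_eq_of_mem ho hm hps hlast
        refine ⟨k, ?_⟩
        simp only [hu, hk, if_true]
        rw [he, max_eq_right (by linarith)]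
    · rw [hrho, max_eq_left (by linarith)]
      refine S.zeta_mem_DGw_of_setpoints hr hs fun k => ?_
      simp only [alphaB, ← hw]
      rcases hk : S.lastTo ℓ k s with _ | ⟨τ, e⟩
      · simp only [hinit, if_false]
        rcases a k with l | e
        · exact ⟨l, rfl⟩
        · exact ⟨e.1.2, rfl⟩
      · have : ¬ s < τ + S.batchDelay ℓ τ := by
          by_cases hτ : τ = p.1
          · rw [hτ]; exact hsd
          · exact hold k τ e hk hτ
        simp only [this, if_false]
        exact ⟨e.1.2, rfl⟩

end Generators
end PowerOps

/-! ### Bounds on disruption and running costs -/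

namespace PowerOps

namespace System

variable {nG nL nc : ℕ} (S : System nG nL nc)

lemma sigInv_sig (x : Load nL) : S.sigInv (S.sig x) = x := by
  have : S.sigInv * S.sig = 1 := by
    unfold sigInv sig
    rw [← map_mul, Matrix.nonsing_inv_mul _ S.σ_nonsingular, map_one]
  simpa using congrArg (fun f => f x) this

lemma sig_sigInv (x : Load nL) : S.sig (S.sigInv x) = x := by
  have : S.sig * S.sigInv = 1 := by
    unfold sigInv sig
    rw [← map_mul, Matrix.mul_nonsing_inv _ S.σ_nonsingular, map_one]
  simpa using congrArg (fun f => f x) this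

lemma costOf_continuous : Continuous S.costOf := by
  unfold costOf
  fun_prop

lemma continuous_posPart : Continuous (posPart : Load nL → Load nL) := by
  unfold posPart
  fun_prop

lemma costOf_nonneg {z : Load nL} (hz : ∀ j, 0 ≤ z j) : 0 ≤ S.costOf z :=
  Finset.sum_nonneg fun j _ => mul_nonneg (S.c_pos j).le (hz j)

lemma posPart_nonneg (x : Load nL) (j : Fin nL) : 0 ≤ posPart x j := le_max_right _ _

lemma costOf_posPart_smul {l : ℝ} (hl : 0 ≤ l) (x : Load nL) :
    S.costOf (posPart (l • x)) = l * S.costOf (posPart x) := by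
  unfold costOf posPart
  rw [Finset.mul_sum]
  refine Finset.sum_congr rfl fun j _ => ?_
  simp only [PiLp.smul_apply, smul_eq_mul]
  have : max (l * x j) 0 = l * max (x j) 0 := by rw [mul_max_of_nonneg _ _ hl, mul_zero]
  rw [this]; ring

lemma bddAbove_kappa : BddAbove {y | ∃ ξ : Load nL, ‖ξ‖ = 1 ∧ y = S.costOf (posPart (S.sig ξ))} := by
  have hc : Continuous fun ξ : Load nL => S.costOf (posPart (S.sig ξ)) :=
    S.costOf_continuous.comp (continuous_posPart.comp S.sig.continuous)
  have := ((isCompact_sphere (0 : Load nL) 1).image hc).bddAbove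
  refine this.mono ?_
  rintro y ⟨ξ, h1, rfl⟩
  exact ⟨ξ, by simpa using h1, rfl⟩

lemma kappa_nonneg : 0 ≤ S.kappa := by
  refine Real.sSup_nonneg ?_
  rintro y ⟨ξ, -, rfl⟩
  exact S.costOf_nonneg (posPart_nonneg _)

/-- With `z = σξ`, positive homogeneity reduces to `‖ξ‖ = 1`, where `kappa` is an upper bound; `ξ =
0` is trivial. -/
lemma costOf_posPart_le (z : Load nL) : S.costOf (posPart z) ≤ ‖S.sigInv z‖ * S.kappa := by
  set ξ := S.sigInv z with hξ
  have hz : z = S.sig ξ := (S.sig_sigInv z).symm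
  rw [hz]
  by_cases h : ξ = 0
  · simp [h, costOf, posPart]
  · have hn : 0 < ‖ξ‖ := norm_pos_iff.2 h
    have h1 : S.sig ξ = ‖ξ‖ • S.sig (‖ξ‖⁻¹ • ξ) := by
      rw [map_smul, smul_smul, mul_inv_cancel₀ hn.ne', one_smul]
    rw [h1, S.costOf_posPart_smul hn.le]
    refine mul_le_mul_of_nonneg_left (le_csSup S.bddAbove_kappa ⟨_, ?_, rfl⟩) hn.le
    rw [norm_smul, norm_inv, norm_norm, inv_mul_cancel₀ hn.ne']

lemma bddBelow_shed (i : Fin (nc + 1)) (p : Fin nG → ℝ) (d : Load nL) :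
    BddBelow {κ | ∃ z : Load nL, (∀ j, 0 ≤ z j) ∧ (p, d - z) ∈ S.G i ∧ κ = S.costOf z} := by
  refine ⟨0, ?_⟩
  rintro κ ⟨z, hz, -, rfl⟩
  exact S.costOf_nonneg hz

lemma shedCost_nonneg (i : Fin (nc + 1)) (p : Fin nG → ℝ) (d : Load nL) : 0 ≤ S.shedCost i p d := by
  refine Real.sInf_nonneg ?_
  rintro κ ⟨z, hz, -, rfl⟩
  exact S.costOf_nonneg hz

/-- Shedding `(x - b)^+` from `x^+` leaves the componentwise minimum of `x^+` and `b`, which is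
feasible because it lies between `0` and `b`. -/
lemma shedCost_le_of_mem {i : Fin (nc + 1)} {p : Fin nG → ℝ} {b : Load nL} (hb : (p, b) ∈ S.G i)
    (x : Load nL) : S.shedCost i p (posPart x) ≤ S.costOf (posPart (x - b)) := by
  have hb0 : ∀ j, 0 ≤ b j := S.G_nonneg i _ hb
  refine csInf_le (S.bddBelow_shed i p _) ⟨posPart (x - b), posPart_nonneg _, ?_, rfl⟩
  refine S.G_oversat i p b hb _ fun j => ?_
  have hj := hb0 j
  simp only [posPart, PiLp.sub_apply]
  rcases le_total (x j) 0 with h | h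
  · rw [max_eq_right h, max_eq_right (by linarith)]
    constructor <;> linarith
  · rw [max_eq_left h]
    rcases le_total (x j) (b j) with h' | h'
    · rw [max_eq_right (by linarith)]
      constructor <;> linarith
    · rw [max_eq_left (by linarith)]
      constructor <;> linarith

lemma shedCost_le {i : Fin (nc + 1)} {p : Fin nG → ℝ} {b : Load nL} (hb : (p, b) ∈ S.G i)
    (x : Load nL) : S.shedCost i p (posPart x) ≤ ‖S.sigInv (x - b)‖ * S.kappa :=
  (S.shedCost_le_of_mem hb x).trans (S.costOf_posPart_le _)

/-- If the segment avoided the frontier, the interior and the complement of `G i` would disconnect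
it. -/
lemma exists_mem_frontier {i : Fin (nc + 1)} {p : Fin nG → ℝ} {b b' : Load nL}
    (hb : (p, b) ∈ S.G i) (hb' : (p, b') ∉ S.G i) :
    ∃ l ∈ Icc (0 : ℝ) 1, (p, b + l • (b' - b)) ∈ frontier (S.G i) := by
  set g : ℝ → (Fin nG → ℝ) × Load nL := fun l => (p, b + l • (b' - b)) with hg
  have hgc : Continuous g := by fun_prop
  by_contra! hcon
  have hcover : Icc 0 1 ⊆ g ⁻¹' interior (S.G i) ∪ g ⁻¹' (S.G i)ᶜ := by
    intro l hl
    by_contra! hl'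
    rw [mem_union, not_or] at hl'
    refine hcon l hl ?_
    rw [(S.G_compact i).isClosed.frontier_eq]
    exact ⟨not_not.1 hl'.2, hl'.1⟩
  have h0 : g 0 ∈ interior (S.G i) := by
    rcases hcover (a := 0) (by simp) with h | h
    · exact h
    · exact absurd hb (by simpa [hg] using h)
  obtain ⟨l, -, hl1, hl2⟩ := isPreconnected_Icc _ _ (isOpen_interior.preimage hgc)
    ((S.G_compact i).isClosed.isOpen_compl.preimage hgc) hcover ⟨0, by simp, h0⟩
    ⟨1, by simp, by simpa [hg] using hb'⟩
  exact hl2 (interior_subset hl1)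

lemma frontier_subset (i : Fin (nc + 1)) : frontier (S.G i) ⊆ S.G i :=
  (S.G_compact i).isClosed.frontier_subset

/-- The distance from `μ` to the boundary of `G i` at production `p`. -/
def frontierDist (i : Fin (nc + 1)) (μ : Load nL) (p : Fin nG → ℝ) : ℝ :=
  sInf {y | ∃ d : Load nL, (p, d) ∈ frontier (S.G i) ∧ y = ‖S.sigInv (d - μ)‖}

open Classical in
/-- The signed distance from `μ` to the boundary of `G i` at production `p`. -/
def signedDist (i : Fin (nc + 1)) (μ : Load nL) (p : Fin nG → ℝ) : ℝ :=
  if (p, μ) ∈ S.G i then S.frontierDist i μ p else -S.frontierDist i μ p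

lemma frontierDist_nonneg (i : Fin (nc + 1)) (μ : Load nL) (p : Fin nG → ℝ) :
    0 ≤ S.frontierDist i μ p := by
  refine Real.sInf_nonneg ?_
  rintro κ ⟨z, -, rfl⟩
  exact norm_nonneg _

lemma frontierDist_le {i : Fin (nc + 1)} {p : Fin nG → ℝ} {b : Load nL} (μ : Load nL)
    (hb : (p, b) ∈ frontier (S.G i)) : S.frontierDist i μ p ≤ ‖S.sigInv (b - μ)‖ := by
  refine csInf_le ⟨0, ?_⟩ ⟨b, hb, rfl⟩
  rintro κ ⟨z, -, rfl⟩
  exact norm_nonneg _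

lemma exists_mem_slice (i : Fin (nc + 1)) {p : Fin nG → ℝ} (hp : p ∈ S.DG) :
    ∃ b, (p, b) ∈ S.G i :=
  (S.G_interior i p hp).imp fun _ h => interior_subset h

lemma exists_not_mem_slice [NeZero nL] (i : Fin (nc + 1)) (p : Fin nG → ℝ) :
    ∃ b, (p, b) ∉ S.G i := by
  refine ⟨WithLp.toLp 2 fun _ => -1, fun h => ?_⟩
  have := S.G_nonneg i _ h 0
  simp at this
  linarith

/-- A segment from a feasible load to the infeasible load with all entries `-1` crosses the
frontier; this needs `nL ≠ 0`. Nonemptiness makes the infimum a genuine distance rather than the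
default `0`. -/
lemma frontierDist_set_nonempty [NeZero nL] (i : Fin (nc + 1)) (μ : Load nL) {p : Fin nG → ℝ}
    (hp : p ∈ S.DG) :
    {y | ∃ d : Load nL, (p, d) ∈ frontier (S.G i) ∧ y = ‖S.sigInv (d - μ)‖}.Nonempty := by
  obtain ⟨b, hb⟩ := S.exists_mem_slice i hp
  obtain ⟨b', hb'⟩ := S.exists_not_mem_slice i p
  obtain ⟨l, -, hl⟩ := S.exists_mem_frontier hb hb'
  exact ⟨_, _, hl, rfl⟩

/-- The bound on the cost of load disruption in terms of the distance of the forecast to the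
boundary of the feasible set. -/
lemma shedCost_le_CB [NeZero nL] (i : Fin (nc + 1)) (t : ℝ) {p : Fin nG → ℝ} (hp : p ∈ S.DG)
    (x : Load nL) : S.shedCost i p (posPart x) ≤ S.CB i t p ‖S.sigInv (x - S.m t)‖ := by
  set μ := S.m t with hμ
  have hκ := S.kappa_nonneg
  have hCB : ∀ y, S.CB i t p y = max 0 (y - S.signedDist i μ p) * S.kappa := fun y => rfl
  rw [hCB]
  by_cases hm : (p, μ) ∈ S.G i
  · have hd : S.signedDist i μ p = S.frontierDist i μ p := if_pos hm
    by_cases hx : (p, x) ∈ S.G i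
    · refine (S.shedCost_le hx x).trans ?_
      rw [sub_self, map_zero, norm_zero, zero_mul]
      exact mul_nonneg (le_max_left _ _) hκ
    -- The segment from `μ` to `x` crosses the frontier at a fraction `l`: the part up to the
    -- crossing is at least the distance `d`, and only the rest has to be shed.
    · obtain ⟨l, hl, hf⟩ := S.exists_mem_frontier hm hx
      refine (S.shedCost_le (S.frontier_subset i hf) x).trans ?_
      refine mul_le_mul_of_nonneg_right (le_max_of_le_right ?_) hκ
      have h1 := S.frontierDist_le μ hf
      have e1 : μ + l • (x - μ) - μ = l • (x - μ) := by abel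
      have e2 : x - (μ + l • (x - μ)) = (1 - l) • (x - μ) := by module
      rw [e1, map_smul, norm_smul, Real.norm_of_nonneg hl.1] at h1
      rw [e2, map_smul, norm_smul, Real.norm_of_nonneg (by linarith [hl.2]), hd]
      linarith
  · have hd : S.signedDist i μ p = -S.frontierDist i μ p := if_neg hm
    rw [hd]
    -- For an infeasible forecast, shedding down to any frontier point `b` is estimated through `μ`
    -- by the triangle inequality; the infimum over `b` follows.
    have key : ∀ b, (p, b) ∈ frontier (S.G i) → S.shedCost i p (posPart x) ≤
        (‖S.sigInv (x - μ)‖ + ‖S.sigInv (b - μ)‖) * S.kappa := by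
      intro b hb
      refine (S.shedCost_le (S.frontier_subset i hb) x).trans ?_
      refine mul_le_mul_of_nonneg_right ?_ hκ
      have : x - b = (x - μ) - (b - μ) := by abel
      rw [this, map_sub]
      exact norm_sub_le _ _
    rw [sub_neg_eq_add, max_eq_right (add_nonneg (norm_nonneg _) (S.frontierDist_nonneg i μ p))]
    -- Passing to the infimum divides by `kappa`, hence the separate case `kappa = 0`.
    rcases hκ.eq_or_lt with h0 | hpos
    · obtain ⟨_, b, hb, -⟩ := S.frontierDist_set_nonempty i μ hp
      have := key b hb
      rw [← h0, mul_zero] at this ⊢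
      exact this
    · have : S.shedCost i p (posPart x) / S.kappa - ‖S.sigInv (x - μ)‖ ≤ S.frontierDist i μ p := by
        refine le_csInf (S.frontierDist_set_nonempty i μ hp) ?_
        rintro y ⟨b, hb, rfl⟩
        have := (div_le_iff₀ hpos).2 (key b hb)
        linarith
      exact (div_le_iff₀ hpos).1 (by linarith)

/-- The signed distances are bounded, locally uniformly in the forecast. -/
lemma exists_abs_signedDist_le [NeZero nL] : ∃ M : ℝ, 0 ≤ M ∧ ∀ i μ, ∀ p ∈ S.DG,
    |S.signedDist i μ p| ≤ M + ‖S.sigInv μ‖ := by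
  have h : ∀ i, ∃ M : ℝ, 0 ≤ M ∧ ∀ g ∈ S.G i, ‖S.sigInv g.2‖ ≤ M := by
    intro i
    have hc : Continuous fun g : (Fin nG → ℝ) × Load nL => ‖S.sigInv g.2‖ := by fun_prop
    obtain ⟨M, hM⟩ := ((S.G_compact i).image hc).bddAbove
    exact ⟨max M 0, le_max_right _ _, fun g hg => (hM ⟨g, hg, rfl⟩).trans (le_max_left _ _)⟩
  choose M hM0 hM using h
  refine ⟨∑ i, M i, Finset.sum_nonneg fun i _ => hM0 i, fun i μ p hp => ?_⟩
  have habs : |S.signedDist i μ p| = S.frontierDist i μ p := by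
    unfold signedDist
    split_ifs
    · exact abs_of_nonneg (S.frontierDist_nonneg i μ p)
    · rw [abs_neg, abs_of_nonneg (S.frontierDist_nonneg i μ p)]
  rw [habs]
  obtain ⟨_, b, hb, -⟩ := S.frontierDist_set_nonempty i μ hp
  refine (S.frontierDist_le μ hb).trans ?_
  rw [map_sub]
  refine (norm_sub_le _ _).trans ?_
  have h1 := hM i _ (S.frontier_subset i hb)
  have h2 : M i ≤ ∑ i, M i := Finset.single_le_sum (fun i _ => hM0 i) (Finset.mem_univ i)
  simp only at h1
  linarith

/-- `f^B_1` as a function of the forecast. -/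
def costAt (μ : Load nL) (p : Fin nG → ℝ) (y : ℝ) : ℝ :=
  S.CG p + ∑ i, S.q i * (max 0 (y - S.signedDist i μ p) * S.kappa)

/-- `f^B_2` as a function of the forecast. -/
def maxCostAt (μ : Load nL) (y : ℝ) (a : S.Mode) (w : ℝ) : ℝ :=
  sSup ((fun p => S.costAt μ p y) '' S.DGw a w)

/-- Time enters only through `m t`, so regularity can be studied in the forecast variable and `m`
replaced by a continuous extension. -/
lemma fB2_eq_maxCostAt (t y : ℝ) (a : S.Mode) (w : ℝ) : S.fB2 t y a w = S.maxCostAt (S.m t) y a w :=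
  rfl

/-- Linear growth of the running costs. -/
lemma exists_abs_costAt_le [NeZero nL] : ∃ M : ℝ, 0 ≤ M ∧ ∀ μ, ∀ p ∈ S.DG, ∀ y,
    |S.costAt μ p y| ≤ M * (1 + ‖S.sigInv μ‖ + |y|) := by
  obtain ⟨M, hM0, hM⟩ := S.exists_abs_signedDist_le
  obtain ⟨C, hC⟩ := S.isCompact_DG.exists_bound_of_continuousOn S.CG_cont
  set Q := ∑ i, S.q i * S.kappa with hQ
  have hQ0 : 0 ≤ Q := Finset.sum_nonneg fun i _ => mul_nonneg (S.q_nonneg i) S.kappa_nonneg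
  refine ⟨|C| + Q * (M + 1), by positivity, fun μ p hp y => ?_⟩
  have h1 : |∑ i, S.q i * (max 0 (y - S.signedDist i μ p) * S.kappa)| ≤
      Q * (M + ‖S.sigInv μ‖ + |y|) := by
    refine (Finset.abs_sum_le_sum_abs _ _).trans ?_
    rw [hQ, Finset.sum_mul]
    refine Finset.sum_le_sum fun i _ => ?_
    rw [abs_mul, abs_mul, abs_of_nonneg (S.q_nonneg i), abs_of_nonneg S.kappa_nonneg,
      abs_of_nonneg (le_max_left 0 _), mul_assoc]
    refine mul_le_mul_of_nonneg_left ?_ (S.q_nonneg i)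
    rw [mul_comm S.kappa]
    refine mul_le_mul_of_nonneg_right (max_le (by positivity) ?_) S.kappa_nonneg
    have := hM i μ p hp
    linarith [neg_abs_le (S.signedDist i μ p), le_abs_self y]
  have h2 : |S.CG p| ≤ |C| := (hC p hp).trans (le_abs_self C)
  have h3 := abs_add_le (S.CG p) (∑ i, S.q i * (max 0 (y - S.signedDist i μ p) * S.kappa))
  have h4 : S.costAt μ p y = S.CG p + ∑ i, S.q i * (max 0 (y - S.signedDist i μ p) * S.kappa) := rfl
  rw [h4]
  -- The cross terms discarded by the crude product constant.
  have e1 : 0 ≤ |C| * (‖S.sigInv μ‖ + |y|) := by positivity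
  have e2 : 0 ≤ Q * (M * (‖S.sigInv μ‖ + |y|)) := by positivity
  nlinarith

lemma bddAbove_costAt [NeZero nL] (μ : Load nL) (y : ℝ) (a : S.Mode) (w : ℝ) :
    BddAbove ((fun p => S.costAt μ p y) '' S.DGw a w) := by
  obtain ⟨M, -, hM⟩ := S.exists_abs_costAt_le
  refine ⟨M * (1 + ‖S.sigInv μ‖ + |y|), ?_⟩
  rintro _ ⟨p, hp, rfl⟩
  exact (le_abs_self _).trans (hM μ p (S.DGw_subset a w hp) y)

lemma exists_abs_maxCostAt_le [NeZero nL] : ∃ M : ℝ, 0 ≤ M ∧ ∀ μ y a w,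
    |S.maxCostAt μ y a w| ≤ M * (1 + ‖S.sigInv μ‖ + |y|) := by
  obtain ⟨M, hM0, hM⟩ := S.exists_abs_costAt_le
  refine ⟨M, hM0, fun μ y a w => ?_⟩
  have hnn : 0 ≤ M * (1 + ‖S.sigInv μ‖ + |y|) := by positivity
  -- For incompatible `a` and `w` the set is empty and the supremum is `0` by convention.
  rcases (S.DGw a w).eq_empty_or_nonempty with h | ⟨p, hp⟩
  · simpa [maxCostAt, h] using hnn
  · rw [abs_le]
    constructor
    · refine le_trans ?_ (le_csSup (S.bddAbove_costAt μ y a w) ⟨p, hp, rfl⟩)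
      exact neg_le_of_abs_le (hM μ p (S.DGw_subset a w hp) y)
    · refine csSup_le ⟨_, p, hp, rfl⟩ ?_
      rintro _ ⟨p, hp, rfl⟩
      exact (le_abs_self _).trans (hM μ p (S.DGw_subset a w hp) y)

/-- The pointwise comparison: the production is a candidate in the maximum, and disruption costs are
bounded configuration by configuration. Only the production links `(a, r)` to `(b, w)`. -/
lemma f_le_maxCostAt [NeZero nL] (t : ℝ) (x : Load nL) {a : S.Mode} {r : Fin nG → ℝ} {b : S.Mode}
    {w : ℝ} (h : S.zeta a r ∈ S.DGw b w) :
    S.f x a r ≤ S.fB2 t ‖S.sigInv (x - S.m t)‖ b w := by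
  have h1 : S.f x a r ≤ S.costAt (S.m t) (S.zeta a r) ‖S.sigInv (x - S.m t)‖ := by
    unfold f costAt
    gcongr with i
    · exact S.q_nonneg i
    · exact S.shedCost_le_CB i t (S.DGw_subset b w h) x
  exact h1.trans (le_csSup (S.bddAbove_costAt _ _ b w) ⟨_, h, rfl⟩)

/-- Zero load is always feasible, so shedding all demand gives a linear bound. -/
lemma exists_abs_shedCost_le : ∃ M : ℝ, 0 ≤ M ∧ ∀ i, ∀ p ∈ S.DG, ∀ x,
    |S.shedCost i p (posPart x)| ≤ M * ‖x‖ := by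
  refine ⟨‖S.sigInv‖ * S.kappa, mul_nonneg (norm_nonneg _) S.kappa_nonneg, fun i p hp x => ?_⟩
  rw [abs_of_nonneg (S.shedCost_nonneg _ _ _)]
  obtain ⟨b, hb⟩ := S.exists_mem_slice i hp
  have hb0 : (p, (0 : Load nL)) ∈ S.G i :=
    S.G_oversat i p b hb 0 fun j => ⟨le_rfl, S.G_nonneg i _ hb j⟩
  refine (S.shedCost_le hb0 x).trans ?_
  rw [sub_zero, mul_right_comm]
  exact mul_le_mul_of_nonneg_right (S.sigInv.le_opNorm x) S.kappa_nonneg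

lemma exists_abs_f_le : ∃ M : ℝ, 0 ≤ M ∧ ∀ x a, ∀ r ∈ S.H a, |S.f x a r| ≤ M * (1 + ‖x‖) := by
  obtain ⟨M, hM0, hM⟩ := S.exists_abs_shedCost_le
  obtain ⟨C, hC⟩ := S.isCompact_DG.exists_bound_of_continuousOn S.CG_cont
  have hQ0 : 0 ≤ ∑ i, S.q i := Finset.sum_nonneg fun i _ => S.q_nonneg i
  refine ⟨|C| + (∑ i, S.q i) * M, by positivity, fun x a r hr => ?_⟩
  have hp := S.zeta_mem_DG hr
  have h1 : |∑ i, S.q i * S.shedCost i (S.zeta a r) (posPart x)| ≤ (∑ i, S.q i) * (M * ‖x‖) := by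
    refine (Finset.abs_sum_le_sum_abs _ _).trans ?_
    rw [Finset.sum_mul]
    refine Finset.sum_le_sum fun i _ => ?_
    rw [abs_mul, abs_of_nonneg (S.q_nonneg i)]
    exact mul_le_mul_of_nonneg_left (hM i _ hp x) (S.q_nonneg i)
  have h2 : |S.CG (S.zeta a r)| ≤ |C| := (hC _ hp).trans (le_abs_self C)
  refine (abs_add_le _ _).trans ?_
  have e1 : 0 ≤ |C| * ‖x‖ := by positivity
  have e2 : 0 ≤ (∑ i, S.q i) * M := by positivity
  nlinarith

/-- Disruption costs are nonnegative and `CG` is bounded on the compact box. The bound is uniform in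
the demand, so it survives for controls whose cost is not known to be integrable. -/
lemma exists_le_f : ∃ M : ℝ, 0 ≤ M ∧ ∀ x a, ∀ r ∈ S.H a, -M ≤ S.f x a r := by
  obtain ⟨C, hC⟩ := S.isCompact_DG.exists_bound_of_continuousOn S.CG_cont
  refine ⟨|C|, abs_nonneg C, fun x a r hr => ?_⟩
  have h2 : |S.CG (S.zeta a r)| ≤ |C| := (hC _ (S.zeta_mem_DG hr)).trans (le_abs_self C)
  have h3 : 0 ≤ ∑ i, S.q i * S.shedCost i (S.zeta a r) (posPart x) :=
    Finset.sum_nonneg fun i _ => mul_nonneg (S.q_nonneg i) (S.shedCost_nonneg _ _ _)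
  unfold f
  linarith [neg_abs_le (S.CG (S.zeta a r))]

end System
end PowerOps

/-! ### Semicontinuity and measurability of the running costs -/

/-- A supremum of an upper semicontinuous function over the fibres of a closed relation with values
in a compact set depends measurably on the parameter. -/
lemma measurable_sSup_image_fiber {Z U : Type*} [TopologicalSpace Z] [MeasurableSpace Z]
    [OpensMeasurableSpace Z] [TopologicalSpace U] [T2Space U] {K : Set U} (hK : IsCompact K)
    {F : Set (Z × U)} (hF : IsClosed F) {h : Z × U → ℝ}
    (husc : UpperSemicontinuousOn h (univ ×ˢ K)) :
    Measurable fun z => sSup ((fun u => h (z, u)) '' {u ∈ K | (z, u) ∈ F}) := by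
  have hfib : ∀ z, IsCompact {u ∈ K | (z, u) ∈ F} := fun z =>
    hK.inter_right (hF.preimage (by fun_prop : Continuous fun u : U => (z, u)))
  have huscz : ∀ z, UpperSemicontinuousOn (fun u => h (z, u)) {u ∈ K | (z, u) ∈ F} := fun z =>
    husc.comp (g := fun u => (z, u)) (by fun_prop) fun u hu => ⟨mem_univ _, hu.1⟩
  -- Projection along a compact set is closed (tube lemma).
  have hproj : ∀ A : Set (Z × U), IsClosed A → IsClosed {z | ∃ u ∈ K, (z, u) ∈ A} := by
    intro A hA
    rw [← isOpen_compl_iff, isOpen_iff_mem_nhds]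
    intro z hz
    have := hK.eventually_forall_of_forall_eventually (x₀ := z) (P := fun z u => (z, u) ∉ A)
      fun u hu => hA.isOpen_compl.mem_nhds fun hu' => hz ⟨u, hu, hu'⟩
    filter_upwards [this] with z' hz' ⟨u, hu, hu'⟩ using hz' u hu hu'
  have hlev : ∀ c, IsClosed {x : Z × U | x.2 ∈ K ∧ x ∈ F ∧ c ≤ h x} := by
    intro c
    rw [← isOpen_compl_iff, isOpen_iff_mem_nhds]
    intro x hx
    by_cases hxK : x.2 ∈ K
    · by_cases hxF : x ∈ F
      · have hlt : h x < c := by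
          by_contra hc
          exact hx ⟨hxK, hxF, not_lt.1 hc⟩
        have := husc x ⟨mem_univ _, hxK⟩ c hlt
        filter_upwards [eventually_nhdsWithin_iff.1 this] with x' hx' hx''
        exact absurd (hx' ⟨mem_univ _, hx''.1⟩) (not_lt.2 hx''.2.2)
      · filter_upwards [hF.isOpen_compl.mem_nhds hxF] with x' hx' hx'' using hx' hx''.2.1
    · filter_upwards [(hK.isClosed.isOpen_compl.preimage continuous_snd).mem_nhds hxK]
        with x' hx' hx'' using hx' hx''.1
  refine measurable_of_Ici fun c => ?_
  -- On nonempty fibres the supremum is attained, so the superlevel set is the projection of a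
  -- closed set; on empty fibres it equals `0`, whence the condition `c ≤ 0`.
  have hset : (fun z => sSup ((fun u => h (z, u)) '' {u ∈ K | (z, u) ∈ F})) ⁻¹' Ici c =
      {z | ∃ u ∈ K, (z, u) ∈ {x : Z × U | x.2 ∈ K ∧ x ∈ F ∧ c ≤ h x}} ∪
      ({z | ∃ u ∈ K, (z, u) ∈ F}ᶜ ∩ {_z | c ≤ 0}) := by
    ext z
    simp only [mem_preimage, mem_Ici]
    rcases ({u ∈ K | (z, u) ∈ F}).eq_empty_or_nonempty with he | hne
    · have h1 : ∀ u ∈ K, (z, u) ∉ F := fun u hu hu' => by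
        have : u ∈ ({u ∈ K | (z, u) ∈ F}) := ⟨hu, hu'⟩
        rw [he] at this
        exact this
      rw [he, image_empty, Real.sSup_empty]
      constructor
      · intro hc
        exact Or.inr ⟨fun ⟨u, hu, hu'⟩ => h1 u hu hu', hc⟩
      · rintro (⟨u, hu, hu'⟩ | hc)
        · exact absurd hu'.2.1 (h1 u hu)
        · exact hc.2
    · obtain ⟨u0, hu0, hmax⟩ := (huscz z).exists_isMaxOn hne (hfib z)
      have hs : sSup ((fun u => h (z, u)) '' {u ∈ K | (z, u) ∈ F}) = h (z, u0) := by
        refine IsGreatest.csSup_eq ⟨⟨u0, hu0, rfl⟩, ?_⟩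
        rintro _ ⟨u, hu, rfl⟩
        exact hmax hu
      rw [hs]
      constructor
      · intro hc
        exact Or.inl ⟨u0, hu0.1, hu0.1, hu0.2, hc⟩
      · rintro (⟨u, hu, hu'⟩ | hc)
        · exact hu'.2.2.trans (hmax ⟨hu, hu'.2.1⟩)
        · exact absurd ⟨u0, hu0.1, hu0.2⟩ hc.1
  rw [hset]
  exact (hproj _ (hlev c)).measurableSet.union
    ((hproj _ hF).measurableSet.compl.inter (MeasurableSet.const _))

namespace PowerOps

namespace System

variable {nG nL nc : ℕ} (S : System nG nL nc)

/-- A level `c ≥ 0` is exceeded when a closed ellipsoid of radius slightly above `c` about the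
forecast lies in the interior, which persists nearby by compactness. A level `c < 0` is exceeded
when a feasible load lies within `-c` of the forecast; convexity moves that load into the interior,
where it stays feasible for nearby productions. -/
lemma lowerSemicontinuousOn_signedDist [NeZero nL] (i : Fin (nc + 1)) :
    LowerSemicontinuousOn (fun z : Load nL × (Fin nG → ℝ) => S.signedDist i z.1 z.2)
      (univ ×ˢ S.DG) := by
  rintro ⟨μ₀, p₀⟩ ⟨-, hp₀⟩ c hc
  simp only at hc hp₀
  by_cases hc0 : 0 ≤ c
  · have hm : (p₀, μ₀) ∈ S.G i := by
      by_contra hm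
      have : S.signedDist i μ₀ p₀ = -S.frontierDist i μ₀ p₀ := if_neg hm
      linarith [S.frontierDist_nonneg i μ₀ p₀]
    have hd : S.signedDist i μ₀ p₀ = S.frontierDist i μ₀ p₀ := if_pos hm
    rw [hd] at hc
    obtain ⟨c', hcc', hc'⟩ := exists_between hc
    have hint : ∀ v : Load nL, v ∈ Metric.closedBall 0 c' →
        (p₀, μ₀ + S.sig v) ∈ interior (S.G i) := by
      intro v hv
      rw [mem_closedBall_zero_iff] at hv
      by_contra hcon
      by_cases hG : (p₀, μ₀ + S.sig v) ∈ S.G i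
      · have hf : (p₀, μ₀ + S.sig v) ∈ frontier (S.G i) := by
          rw [(S.G_compact i).isClosed.frontier_eq]; exact ⟨hG, hcon⟩
        have := S.frontierDist_le μ₀ hf
        rw [add_sub_cancel_left, S.sigInv_sig] at this
        linarith
      · obtain ⟨l, hl, hf⟩ := S.exists_mem_frontier hm hG
        have := S.frontierDist_le μ₀ hf
        rw [add_sub_cancel_left, add_sub_cancel_left, map_smul, S.sigInv_sig, norm_smul,
          Real.norm_of_nonneg hl.1] at this
        have h2 : l * ‖v‖ ≤ 1 * ‖v‖ := mul_le_mul_of_nonneg_right hl.2 (norm_nonneg v)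
        linarith
    have hev : ∀ᶠ z : Load nL × (Fin nG → ℝ) in 𝓝 (μ₀, p₀), ∀ v ∈ Metric.closedBall (0 : Load nL) c',
        (z.2, z.1 + S.sig v) ∈ interior (S.G i) := by
      refine (isCompact_closedBall (0 : Load nL) c').eventually_forall_of_forall_eventually
        (P := fun (z : Load nL × (Fin nG → ℝ)) v => (z.2, z.1 + S.sig v) ∈ interior (S.G i)) fun v hv => ?_
      have hcont : Continuous fun y : (Load nL × (Fin nG → ℝ)) × Load nL =>
        (y.1.2, y.1.1 + S.sig y.2) := by fun_prop
      exact (isOpen_interior.preimage hcont).mem_nhds (hint v hv)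
    filter_upwards [eventually_nhdsWithin_of_eventually_nhds hev, self_mem_nhdsWithin]
      with ⟨μ, p⟩ hz ⟨_, hp⟩
    simp only at hz hp ⊢
    have hm' : (p, μ) ∈ S.G i := by
      have := hz 0 (by simpa using hc0.trans hcc'.le)
      rw [map_zero, add_zero] at this
      exact interior_subset this
    have hd' : S.signedDist i μ p = S.frontierDist i μ p := if_pos hm'
    rw [hd']
    refine hcc'.trans_le (le_csInf (S.frontierDist_set_nonempty i μ hp) ?_)
    rintro _ ⟨b, hb, rfl⟩
    by_contra hlt
    have := hz (S.sigInv (b - μ)) (by simpa using (not_le.1 hlt).le)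
    rw [S.sig_sigInv, add_sub_cancel] at this
    exact hb.2 this
  · rw [not_le] at hc0
    obtain ⟨b₁, hb₁, hb₁'⟩ : ∃ b, (p₀, b) ∈ S.G i ∧ ‖S.sigInv (b - μ₀)‖ < -c := by
      by_cases hm : (p₀, μ₀) ∈ S.G i
      · exact ⟨μ₀, hm, by simpa using hc0⟩
      · have hd : S.signedDist i μ₀ p₀ = -S.frontierDist i μ₀ p₀ := if_neg hm
        obtain ⟨_, ⟨b, hb, rfl⟩, hlt⟩ := exists_lt_of_csInf_lt
          (S.frontierDist_set_nonempty i μ₀ hp₀) (show S.frontierDist i μ₀ p₀ < -c by linarith)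
        exact ⟨b, S.frontier_subset i hb, hlt⟩
    obtain ⟨d₀, hd₀⟩ := S.G_interior i p₀ hp₀
    -- A small step from `b₁` towards the interior point `d₀` reaches the interior by convexity and
    -- keeps the strict distance bound.
    obtain ⟨b, hb, hb'⟩ : ∃ b, (p₀, b) ∈ interior (S.G i) ∧ ‖S.sigInv (b - μ₀)‖ < -c := by
      have hcont : Continuous fun ε : ℝ => ‖S.sigInv (b₁ + ε • (d₀ - b₁) - μ₀)‖ := by fun_prop
      have h0 : ∀ᶠ ε : ℝ in 𝓝 0, ‖S.sigInv (b₁ + ε • (d₀ - b₁) - μ₀)‖ < -c :=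
        hcont.tendsto 0 |>.eventually_lt_const (by simpa using hb₁')
      have h1 : ∀ᶠ ε : ℝ in 𝓝[>] 0, ε ∈ Ioo (0 : ℝ) 1 := Ioo_mem_nhdsGT one_pos
      obtain ⟨ε, hε, hε'⟩ := ((eventually_nhdsWithin_of_eventually_nhds h0).and h1).exists
      refine ⟨b₁ + ε • (d₀ - b₁), ?_, hε⟩
      have := (S.G_convex i).add_smul_sub_mem_interior hb₁ hd₀ (t := ε) ⟨hε'.1, hε'.2.le⟩
      simpa using this
    have hev1 : ∀ᶠ z : Load nL × (Fin nG → ℝ) in 𝓝 (μ₀, p₀), (z.2, b) ∈ interior (S.G i) :=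
      (isOpen_interior.preimage (by fun_prop :
        Continuous fun z : Load nL × (Fin nG → ℝ) => (z.2, b))).mem_nhds hb
    have hev2 : ∀ᶠ z : Load nL × (Fin nG → ℝ) in 𝓝 (μ₀, p₀), ‖S.sigInv (b - z.1)‖ < -c := by
      have hcont : Continuous fun z : Load nL × (Fin nG → ℝ) => ‖S.sigInv (b - z.1)‖ := by fun_prop
      exact (hcont.tendsto (μ₀, p₀)).eventually_lt_const hb'
    filter_upwards [eventually_nhdsWithin_of_eventually_nhds hev1,
      eventually_nhdsWithin_of_eventually_nhds hev2] with ⟨μ, p⟩ h1 h2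
    simp only at h1 h2 ⊢
    by_cases hm : (p, μ) ∈ S.G i
    · have hd : S.signedDist i μ p = S.frontierDist i μ p := if_pos hm
      rw [hd]
      exact hc0.trans_le (S.frontierDist_nonneg i μ p)
    · have hd : S.signedDist i μ p = -S.frontierDist i μ p := if_neg hm
      -- The segment from `b` to the infeasible `μ` meets the frontier no farther from `μ` than `b`
      -- is.
      obtain ⟨l, hl, hf⟩ := S.exists_mem_frontier (interior_subset h1) hm
      have h3 := S.frontierDist_le μ hf
      have e1 : b + l • (μ - b) - μ = (1 - l) • (b - μ) := by module
      rw [e1, map_smul, norm_smul, Real.norm_of_nonneg (by linarith [hl.2])] at h3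
      have h4 : (1 - l) * ‖S.sigInv (b - μ)‖ ≤ 1 * ‖S.sigInv (b - μ)‖ :=
        mul_le_mul_of_nonneg_right (by linarith [hl.1]) (norm_nonneg _)
      linarith

/-- The cost is nonincreasing in each signed distance, so lower semicontinuity turns into upper
semicontinuity. -/
lemma upperSemicontinuousOn_costAt [NeZero nL] :
    UpperSemicontinuousOn (fun z : (Load nL × ℝ) × (Fin nG → ℝ) => S.costAt z.1.1 z.2 z.1.2)
      (univ ×ˢ S.DG) := by
  have h1 : UpperSemicontinuousOn (fun z : (Load nL × ℝ) × (Fin nG → ℝ) => S.CG z.2)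
      (univ ×ˢ S.DG) :=
    (S.CG_cont.comp continuousOn_snd fun z hz => hz.2).upperSemicontinuousOn
  refine h1.add (upperSemicontinuousOn_sum fun i _ => ?_)
  have h2 : LowerSemicontinuousOn
      (fun z : (Load nL × ℝ) × (Fin nG → ℝ) => S.signedDist i z.1.1 z.2) (univ ×ˢ S.DG) :=
    (S.lowerSemicontinuousOn_signedDist i).comp
      (g := fun z : (Load nL × ℝ) × (Fin nG → ℝ) => (z.1.1, z.2)) (by fun_prop)
      fun z hz => ⟨mem_univ _, hz.2⟩
  have h3 : UpperSemicontinuousOn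
      (fun z : (Load nL × ℝ) × (Fin nG → ℝ) => z.1.2 + -S.signedDist i z.1.1 z.2)
      (univ ×ˢ S.DG) :=
    (by fun_prop : ContinuousOn (fun z : (Load nL × ℝ) × (Fin nG → ℝ) => z.1.2) _
      ).upperSemicontinuousOn.add
      ((by fun_prop : Continuous fun u : ℝ => -u).comp_lowerSemicontinuousOn_antitone h2
        fun u v huv => neg_le_neg huv)
  have h4 := (by fun_prop : Continuous fun u : ℝ =>
    S.q i * (max 0 u * S.kappa)).comp_upperSemicontinuousOn h3 fun u v huv =>
      mul_le_mul_of_nonneg_left (mul_le_mul_of_nonneg_right (max_le_max le_rfl huv) S.kappa_nonneg)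
        (S.q_nonneg i)
  simpa only [Function.comp_def, ← sub_eq_add_neg] using h4

end System

namespace Generators

variable {nG : ℕ} (S : Generators nG)

lemma nonneg_of_mem_H {a : S.Mode} {r : Fin nG → ℝ} (hr : r ∈ S.H a) (k : Fin nG) : 0 ≤ r k := by
  have := hr k
  rcases ha : a k with l | e <;> simp only [ha] at this
  · exact this.ge
  · exact this.1

lemma DGw_eq_empty {a : S.Mode} {w : ℝ} (hw : w < 0) : S.DGw a w = ∅ := by
  have : {p | p ∈ S.DG ∧ ∃ r ∈ S.H a, S.psi a r = w ∧ S.zeta a r = p} = ∅ := by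
    refine eq_empty_of_forall_notMem ?_
    rintro p ⟨-, r, hr, hψ, -⟩
    linarith [S.psi_nonneg hr]
  rw [DGw, this, closure_empty]

/-- Transitions in `H(a)` have strictly positive time left, so `ψ = 0` forces set-points only and `r
= 0`. -/
lemma DGw_zero (a : S.Mode) : S.DGw a 0 = ∅ ∨ S.DGw a 0 = {S.zeta a 0} := by
  by_cases h : ∀ r ∈ S.H a, S.psi a r ≠ 0
  · left
    have : {p | p ∈ S.DG ∧ ∃ r ∈ S.H a, S.psi a r = 0 ∧ S.zeta a r = p} = ∅ := by
      refine eq_empty_of_forall_notMem ?_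
      rintro p ⟨-, r, hr, hψ, -⟩
      exact h r hr hψ
    rw [DGw, this, closure_empty]
  · right
    push Not at h
    have key : ∀ r ∈ S.H a, S.psi a r = 0 → r = 0 := by
      intro r hr hψ
      funext k
      have h1 := S.le_psi a r k
      have h2 := hr k
      rcases ha : a k with l | e <;> simp only [ha, modeDelay] at h1 h2
      · exact h2
      · linarith [h2.2]
    obtain ⟨r, hr, hψ⟩ := h
    have : {p | p ∈ S.DG ∧ ∃ r ∈ S.H a, S.psi a r = 0 ∧ S.zeta a r = p} = {S.zeta a 0} := by
      have h0 := key r hr hψ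
      subst h0
      ext p
      constructor
      · rintro ⟨-, r', hr', hψ', rfl⟩
        rw [key r' hr' hψ']; rfl
      · rintro rfl
        exact ⟨S.zeta_mem_DG hr, _, hr, hψ, rfl⟩
    rw [DGw, this, closure_singleton]

lemma isCompact_remaining (a : S.Mode) : IsCompact (Set.univ.pi (S.remaining a)) :=
  isCompact_univ_pi fun _ => isCompact_Icc

lemma output_mem_DG {a : S.Mode} {u : Fin nG → ℝ} (hu : u ∈ Set.univ.pi (S.remaining a)) :
    S.output a u ∈ S.DG := by
  intro k
  have huk := hu k (mem_univ k)
  unfold output zeta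
  rcases ha : a k with l | e
  · exact S.θ_mem k l
  · simp only [remaining, ha, modeDelay] at huk ⊢
    exact S.ramp_mem e.2 ⟨by linarith [huk.2], by linarith [huk.1]⟩

/-- The image is compact, contains the productions with `ψ = w`, and lies in their closure by
`output_mem_DGw`. Positivity matters: at `w = 0` a mode with a transition has nonempty image but
empty `D_G(a,0)`. -/
lemma DGw_eq_image {a : S.Mode} {w : ℝ} (hw : 0 < w) :
    S.DGw a w = S.output a ''
      {u ∈ Set.univ.pi (S.remaining a) | (∀ k, u k ≤ w) ∧ ∃ k, u k = w} := by
  have hcl : IsClosed {u : Fin nG → ℝ | (∀ k, u k ≤ w) ∧ ∃ k, u k = w} := by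
    have e : {u : Fin nG → ℝ | (∀ k, u k ≤ w) ∧ ∃ k, u k = w} =
        (⋂ k, {u | u k ≤ w}) ∩ ⋃ k, {u | u k = w} := by
      ext u; simp
    rw [e]
    exact (isClosed_iInter fun k => isClosed_le (continuous_apply k) continuous_const).inter
      (isClosed_iUnion_of_finite fun k => isClosed_eq (continuous_apply k) continuous_const)
  refine Subset.antisymm (closure_minimal ?_ ?_) ?_
  · rintro p ⟨-, r, hr, hψ, rfl⟩
    refine ⟨fun k => S.modeDelay k (a k) - r k, ⟨fun k _ => ⟨S.sub_nonneg_of_mem_H hr k, ?_⟩,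
      fun k => hψ ▸ S.le_psi a r k, ?_⟩, ?_⟩
    · exact sub_le_self _ (S.nonneg_of_mem_H hr k)
    · have hne : Nonempty (Fin nG) := by
        by_contra hne
        rw [not_nonempty_iff] at hne
        rw [psi, Real.iSup_of_isEmpty] at hψ
        linarith
      obtain ⟨k, hk⟩ := exists_eq_ciSup_of_finite (f := fun k => S.modeDelay k (a k) - r k)
      exact ⟨k, hk.trans hψ⟩
    · unfold output
      simp only [sub_sub_cancel]
  · refine IsCompact.isClosed ?_
    exact ((S.isCompact_remaining a).inter_right hcl).image_of_continuousOn
      ((S.output_continuousOn a).mono inter_subset_left)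
  · rintro _ ⟨u, ⟨hu, hle, hex⟩, rfl⟩
    exact S.output_mem_DGw hu hle hex hw

end Generators

namespace System

variable {nG nL nc : ℕ} (S : System nG nL nc)

lemma measurable_costAt [NeZero nL] {p : Fin nG → ℝ} (hp : p ∈ S.DG) :
    Measurable fun z : Load nL × ℝ => S.costAt z.1 p z.2 := by
  refine UpperSemicontinuous.measurable ?_
  rw [← upperSemicontinuousOn_univ_iff]
  exact S.upperSemicontinuousOn_costAt.comp (g := fun z : Load nL × ℝ => (z, p)) (by fun_prop)
    fun z _ => ⟨mem_univ _, hp⟩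

/-- For positive remaining time this is a supremum over closed fibres of a fixed compact set; at
zero the set has at most one point, and below zero it is empty. -/
lemma measurable_maxCostAt [NeZero nL] (a : S.Mode) :
    Measurable fun z : (Load nL × ℝ) × ℝ => S.maxCostAt z.1.1 z.1.2 a z.2 := by
  set F : Set (((Load nL × ℝ) × ℝ) × (Fin nG → ℝ)) :=
    {x | (∀ k, x.2 k ≤ x.1.2) ∧ ∃ k, x.2 k = x.1.2} with hF
  have hFc : IsClosed F := by
    have e : F = (⋂ k, {x | x.2 k ≤ x.1.2}) ∩ ⋃ k, {x | x.2 k = x.1.2} := by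
      ext u; simp [hF]
    rw [e]
    exact (isClosed_iInter fun k => isClosed_le (by fun_prop) (by fun_prop)).inter
      (isClosed_iUnion_of_finite fun k => isClosed_eq (by fun_prop) (by fun_prop))
  have husc : UpperSemicontinuousOn (fun x : ((Load nL × ℝ) × ℝ) × (Fin nG → ℝ) =>
      S.costAt x.1.1.1 (S.output a x.2) x.1.1.2) (univ ×ˢ Set.univ.pi (S.remaining a)) := by
    refine S.upperSemicontinuousOn_costAt.comp
      (g := fun x : ((Load nL × ℝ) × ℝ) × (Fin nG → ℝ) => (x.1.1, S.output a x.2)) ?_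
      fun x hx => ⟨mem_univ _, S.output_mem_DG hx.2⟩
    exact ContinuousOn.prodMk (by fun_prop)
      ((S.output_continuousOn a).comp continuousOn_snd fun x hx => hx.2)
  have hpos := measurable_sSup_image_fiber (S.isCompact_remaining a) hFc husc
  have hzero : Measurable fun z : (Load nL × ℝ) × ℝ => S.maxCostAt z.1.1 z.1.2 a 0 := by
    rcases S.DGw_zero a with h | h
    · simp only [maxCostAt, h, image_empty, Real.sSup_empty]
      exact measurable_const
    · simp only [maxCostAt, h, image_singleton, csSup_singleton]
      have hm : S.zeta a 0 ∈ S.DG := S.DGw_subset a 0 (h ▸ mem_singleton _)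
      exact (S.measurable_costAt hm).comp measurable_fst
  have hm1 : MeasurableSet {z : (Load nL × ℝ) × ℝ | 0 < z.2} :=
    measurableSet_lt measurable_const measurable_snd
  have hm2 : MeasurableSet {z : (Load nL × ℝ) × ℝ | z.2 = 0} :=
    measurableSet_eq_fun measurable_snd measurable_const
  classical
  set g : (Load nL × ℝ) × ℝ → ℝ := fun z => sSup ((fun u => S.costAt z.1.1 (S.output a u) z.1.2) ''
    {u | u ∈ univ.pi (S.remaining a) ∧ (z, u) ∈ F}) with hg
  have e : (fun z : (Load nL × ℝ) × ℝ => S.maxCostAt z.1.1 z.1.2 a z.2) =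
      fun z => if 0 < z.2 then g z else if z.2 = 0 then S.maxCostAt z.1.1 z.1.2 a 0 else 0 := by
    funext z
    split_ifs with h1 h2
    · rw [maxCostAt, S.DGw_eq_image h1, image_image]
      rfl
    · rw [h2]
    · have h3 : z.2 < 0 := lt_of_le_of_ne (not_lt.1 h1) h2
      rw [maxCostAt, S.DGw_eq_empty h3, image_empty, Real.sSup_empty]
  rw [e]
  exact Measurable.ite hm1 hpos (Measurable.ite hm2 hzero measurable_const)

/-- In terms of the served load `b = d - z` the minimum runs over feasible `b ≤ d`, all in the
compact projection of `G i`; a change of sign turns it into a supremum over fibres. -/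
lemma measurable_shedCost (i : Fin (nc + 1)) :
    Measurable fun z : (Fin nG → ℝ) × Load nL => S.shedCost i z.1 z.2 := by
  have hK : IsCompact (Prod.snd '' S.G i) := (S.G_compact i).image continuous_snd
  have hF : IsClosed {x : ((Fin nG → ℝ) × Load nL) × Load nL |
      (x.1.1, x.2) ∈ S.G i ∧ ∀ j, x.2 j ≤ x.1.2 j} := by
    refine IsClosed.inter ((S.G_compact i).isClosed.preimage (by fun_prop : Continuous
      fun x : ((Fin nG → ℝ) × Load nL) × Load nL => (x.1.1, x.2))) ?_
    have e : {x : ((Fin nG → ℝ) × Load nL) × Load nL | ∀ j, x.2 j ≤ x.1.2 j} =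
        ⋂ j, {x | x.2 j ≤ x.1.2 j} := by ext; simp
    have h : IsClosed {x : ((Fin nG → ℝ) × Load nL) × Load nL | ∀ j, x.2 j ≤ x.1.2 j} := by
      rw [e]
      exact isClosed_iInter fun j => isClosed_le (by fun_prop) (by fun_prop)
    exact h
  have hc : Continuous fun x : ((Fin nG → ℝ) × Load nL) × Load nL => -S.costOf (x.1.2 - x.2) :=
    (S.costOf_continuous.comp (by fun_prop)).neg
  have := (measurable_sSup_image_fiber hK hF hc.continuousOn.upperSemicontinuousOn).neg
  convert this using 1
  funext z
  simp only [shedCost]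
  rw [Real.sInf_def]
  congr 2
  ext κ
  simp only [Set.mem_neg, mem_image]
  constructor
  · rintro ⟨w, hw, hG, hκ⟩
    refine ⟨z.2 - w, ⟨⟨_, hG, rfl⟩, hG, fun j => ?_⟩, ?_⟩
    · have := hw j
      simp only [PiLp.sub_apply]; linarith
    · rw [sub_sub_cancel, ← hκ, neg_neg]
  · rintro ⟨b, ⟨-, hG, hb⟩, rfl⟩
    refine ⟨z.2 - b, fun j => ?_, by simpa using hG, neg_neg _⟩
    have := hb j
    simp only [PiLp.sub_apply]; linarith

open Classical in
/-- The running cost as a measurable function of the demand and the production. -/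
def runCost (x : Load nL) (p : Fin nG → ℝ) : ℝ :=
  S.DG.piecewise S.CG (fun _ => 0) p + ∑ i, S.q i * S.shedCost i p (posPart x)

/-- `CG` is controlled only on the closed box, hence its extension by zero. -/
lemma measurable_runCost :
    Measurable fun z : Load nL × (Fin nG → ℝ) => S.runCost z.1 z.2 := by
  classical
  unfold runCost
  refine Measurable.add ?_ (Finset.measurable_sum _ fun i _ => Measurable.const_mul ?_ _)
  · exact (S.CG_cont.measurable_piecewise continuousOn_const
      S.isCompact_DG.isClosed.measurableSet).comp measurable_snd
  · exact (S.measurable_shedCost i).comp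
      (measurable_snd.prodMk (continuous_posPart.measurable.comp measurable_fst))

lemma f_eq_runCost (x : Load nL) {a : S.Mode} {r : Fin nG → ℝ} (hr : r ∈ S.H a) :
    S.f x a r = S.runCost x (S.zeta a r) := by
  classical
  unfold f runCost
  rw [Set.piecewise_eq_of_mem _ _ _ (S.zeta_mem_DG hr)]

end System
end PowerOps

/-- Used to freeze discrete data such as the mode, the index of the last request or the sequence of
request types. The pieces may overlap. -/
lemma measurable_of_countable_cover {X Y ι : Type*} [MeasurableSpace X] [MeasurableSpace Y]
    [Countable ι] {A : ι → Set X} (hA : ∀ i, MeasurableSet (A i)) (hcov : ∀ x, ∃ i, x ∈ A i)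
    {h : X → Y} {g : ι → X → Y} (hg : ∀ i, Measurable (g i)) (heq : ∀ i, ∀ x ∈ A i, h x = g i x) :
    Measurable h := by
  intro B hB
  have : h ⁻¹' B = ⋃ i, A i ∩ g i ⁻¹' B := by
    ext x
    simp only [mem_preimage, mem_iUnion, mem_inter_iff]
    constructor
    · intro hx
      obtain ⟨i, hi⟩ := hcov x
      exact ⟨i, hi, heq i x hi ▸ hx⟩
    · rintro ⟨i, hi, hx⟩
      exact heq i x hi ▸ hx
  rw [this]
  exact MeasurableSet.iUnion fun i => (hA i).inter (hg i hB)

/-! ### Measurability along random request lists -/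

namespace PowerOps

namespace Generators

variable {nG : ℕ} (S : Generators nG) {Ω : Type*} [MeasurableSpace Ω]

/-- A random request list all of whose entries are random variables. -/
def MeasurableControl (v : Ω → S.Requests) : Prop :=
  ∀ (j : ℕ) (b : S.Request) (s : ℝ), MeasurableSet {ω | ∃ p, (v ω)[j]? = some p ∧ p.2 = b ∧ p.1 ≤ s}

/-- The time of the `j`-th request, with value `0` if there is none. -/
def time (v : Ω → S.Requests) (j : ℕ) (ω : Ω) : ℝ := ((v ω)[j]?).elim 0 Prod.fst

variable {S} {v : Ω → S.Requests}

omit [MeasurableSpace Ω] in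
lemma time_eq {j : ℕ} {ω : Ω} {p : ℝ × S.Request} (h : (v ω)[j]? = some p) :
    S.time v j ω = p.1 := by
  simp [time, h]

lemma MeasurableControl.measurableSet_type (hv : S.MeasurableControl v) (j : ℕ) (b : S.Request) :
    MeasurableSet {ω | ∃ p, (v ω)[j]? = some p ∧ p.2 = b} := by
  have : {ω | ∃ p, (v ω)[j]? = some p ∧ p.2 = b} =
      ⋃ n : ℕ, {ω | ∃ p, (v ω)[j]? = some p ∧ p.2 = b ∧ p.1 ≤ n} := by
    ext ω
    simp only [mem_iUnion]
    constructor
    · rintro ⟨p, h1, h2⟩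
      obtain ⟨n, hn⟩ := exists_nat_ge p.1
      exact ⟨n, p, h1, h2, hn⟩
    · rintro ⟨n, p, h1, h2, -⟩
      exact ⟨p, h1, h2⟩
  rw [this]
  exact MeasurableSet.iUnion fun n => hv j b n

lemma MeasurableControl.measurable_time (hv : S.MeasurableControl v) (j : ℕ) :
    Measurable (S.time v j) := by
  refine measurable_of_Iic fun s => ?_
  -- The second set collects the outcomes without a `j`-th request, where the time is `0` by
  -- convention.
  have : S.time v j ⁻¹' Iic s = (⋃ b, {ω | ∃ p, (v ω)[j]? = some p ∧ p.2 = b ∧ p.1 ≤ s}) ∪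
      ((⋃ b, {ω | ∃ p, (v ω)[j]? = some p ∧ p.2 = b})ᶜ ∩ {_ω | 0 ≤ s}) := by
    ext ω
    simp only [mem_preimage, mem_Iic, mem_union, mem_iUnion, mem_inter_iff, mem_compl_iff]
    rcases hp : (v ω)[j]? with _ | p
    · have e : S.time v j ω = 0 := by simp [time, hp]
      rw [e]
      constructor
      · intro h
        refine Or.inr ⟨?_, h⟩
        rintro ⟨b, p, h1, -⟩
        rw [hp] at h1; cases h1
      · rintro (⟨b, p, h1, -⟩ | h)
        · rw [hp] at h1; cases h1
        · exact h.2
    · rw [time_eq hp]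
      constructor
      · intro h
        exact Or.inl ⟨p.2, p, hp, rfl, h⟩
      · rintro (⟨b, p', h1, -, h2⟩ | h)
        · rw [hp] at h1; cases h1; exact h2
        · exact absurd ⟨p.2, p, hp, rfl⟩ h.1
  rw [this]
  exact (MeasurableSet.iUnion fun b => hv j b s).union
    ((MeasurableSet.iUnion fun b => hv.measurableSet_type j b).compl.inter (MeasurableSet.const _))

lemma MeasurableControl.measurableSet_request_le (hv : S.MeasurableControl v) (j : ℕ) (b : S.Request) :
    MeasurableSet {z : ℝ × Ω | ∃ p, (v z.2)[j]? = some p ∧ p.2 = b ∧ p.1 ≤ z.1} := by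
  have : {z : ℝ × Ω | ∃ p, (v z.2)[j]? = some p ∧ p.2 = b ∧ p.1 ≤ z.1} =
      Prod.snd ⁻¹' {ω | ∃ p, (v ω)[j]? = some p ∧ p.2 = b} ∩ {z | S.time v j z.2 ≤ z.1} := by
    ext z
    constructor
    · rintro ⟨p, h1, h2, h3⟩
      exact ⟨⟨p, h1, h2⟩, (time_eq h1).le.trans h3⟩
    · rintro ⟨⟨p, h1, h2⟩, h3⟩
      exact ⟨p, h1, h2, (time_eq h1).ge.trans h3⟩
  rw [this]
  exact (measurable_snd (hv.measurableSet_type j b)).inter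
    (measurableSet_le ((hv.measurable_time j).comp measurable_snd) measurable_fst)

/-- Functions of the last request of a class `R` up to the current time are measurable. -/
lemma MeasurableControl.measurable_of_last (hv : S.MeasurableControl v) (R : Set S.Request)
    {Y : Type*} [MeasurableSpace Y] {h : ℝ × Ω → Y} {g₀ : ℝ × Ω → Y}
    {g : S.Request → ℝ × (ℝ × Ω) → Y} (hg₀ : Measurable g₀) (hg : ∀ b ∈ R, Measurable (g b))
    (h0 : ∀ z, (∀ p ∈ v z.2, p.2 ∈ R → ¬ p.1 ≤ z.1) → h z = g₀ z)
    (h1 : ∀ z (j : ℕ) p, (v z.2)[j]? = some p → p.2 ∈ R → p.1 ≤ z.1 →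
      (∀ j' > j, ∀ p', (v z.2)[j']? = some p' → p'.2 ∈ R → ¬ p'.1 ≤ z.1) → h z = g p.2 (p.1, z)) :
    Measurable h := by
  classical
  -- `none`: no request of the class so far; `some (j, b)`: the last one is the `j`-th entry and has
  -- type `b`.
  let A : Option (ℕ × R) → Set (ℝ × Ω) := fun i =>
    match i with
    | none => ⋂ (j : ℕ) (b : R), {z | ∃ p, (v z.2)[j]? = some p ∧ p.2 = b ∧ p.1 ≤ z.1}ᶜ
    | some (j, b) => {z | ∃ p, (v z.2)[j]? = some p ∧ p.2 = b ∧ p.1 ≤ z.1} ∩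
        ⋂ (j' : ℕ) (_ : j < j') (b' : R), {z | ∃ p, (v z.2)[j']? = some p ∧ p.2 = b' ∧ p.1 ≤ z.1}ᶜ
  let G : Option (ℕ × R) → ℝ × Ω → Y := fun i =>
    match i with
    | none => g₀
    | some (j, b) => fun z => g b (S.time v j z.2, z)
  refine measurable_of_countable_cover (A := A) (g := G) ?_ ?_ ?_ ?_
  · rintro (_ | ⟨j, b⟩)
    · exact MeasurableSet.iInter fun j => MeasurableSet.iInter fun b =>
        (hv.measurableSet_request_le j b).compl
    · exact (hv.measurableSet_request_le j b).inter (MeasurableSet.iInter fun j' =>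
        MeasurableSet.iInter fun _ => MeasurableSet.iInter fun b' =>
          (hv.measurableSet_request_le j' b').compl)
  · intro z
    rcases hl : ((v z.2).filter fun p => p.2 ∈ R ∧ p.1 ≤ z.1).getLast? with _ | p
    · refine ⟨none, ?_⟩
      rw [List.getLast?_eq_none_iff, List.filter_eq_nil_iff] at hl
      simp only [A, mem_iInter, mem_compl_iff]
      rintro j b ⟨p, hp1, hp2, hp3⟩
      exact hl p (List.mem_iff_getElem?.2 ⟨j, hp1⟩) (by simp [hp2, hp3])
    · obtain ⟨j, hj1, hj2, hj3⟩ := (List.getLast?_filter_eq_some_iff ..).1 hl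
      simp only [decide_eq_true_eq] at hj2 hj3
      refine ⟨some (j, ⟨p.2, hj2.1⟩), ⟨p, hj1, rfl, hj2.2⟩, ?_⟩
      simp only [mem_iInter, mem_compl_iff]
      rintro j' hj' b' ⟨p', hp1, hp2, hp3⟩
      exact hj3 j' hj' p' hp1 ⟨hp2 ▸ b'.2, hp3⟩
  · rintro (_ | ⟨j, b⟩)
    · exact hg₀
    · exact (hg b b.2).comp (((hv.measurable_time j).comp measurable_snd).prodMk measurable_id)
  · rintro (_ | ⟨j, b⟩) z hz
    · refine h0 z fun p hp hR hle => ?_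
      obtain ⟨j, hj⟩ := List.mem_iff_getElem?.1 hp
      simp only [A, mem_iInter, mem_compl_iff] at hz
      exact hz j ⟨p.2, hR⟩ ⟨p, hj, rfl, hle⟩
    · obtain ⟨⟨p, hp1, hp2, hp3⟩, hz2⟩ := hz
      simp only [mem_iInter, mem_compl_iff] at hz2
      have := h1 z j p hp1 (hp2 ▸ b.2) hp3 fun j' hj' p' hp' hR hle =>
        hz2 j' hj' ⟨p'.2, hR⟩ ⟨p', hp', rfl, hle⟩
      simp only [G]
      rw [this, time_eq hp1, hp2]

lemma MeasurableControl.measurable_of_lastTo (hv : S.MeasurableControl v) (k : Fin nG)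
    {Y : Type*} [MeasurableSpace Y] {h : ℝ × Ω → Y} {g₀ : ℝ × Ω → Y}
    {g : S.Edge k → ℝ × (ℝ × Ω) → Y} (hg₀ : Measurable g₀) (hg : ∀ e, Measurable (g e))
    (h0 : ∀ z, S.lastTo (v z.2) k z.1 = none → h z = g₀ z)
    (h1 : ∀ z τ e, S.lastTo (v z.2) k z.1 = some (τ, e) → h z = g e (τ, z)) :
    Measurable h := by
  classical
  refine hv.measurable_of_last {b | b.1 = k} (g₀ := g₀)
    (g := fun b => if hb : b.1 = k then g (hb ▸ b.2) else fun z => g₀ z.2) hg₀ ?_ ?_ ?_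
  · rintro ⟨k', e⟩ hb
    have hb' : k' = k := hb
    subst hb'
    simpa using hg e
  · intro z hz
    exact h0 z ((S.lastTo_eq_none_iff ..).2 hz)
  · rintro z j ⟨τ, k', e⟩ hj hb hle hlast
    have hb' : k' = k := hb
    subst hb'
    simp only [↓reduceDIte]
    exact h1 z τ e ((S.lastTo_eq_some_iff ..).2 ⟨j, hj, hle, hlast⟩)

lemma MeasurableControl.measurable_batchDelay (hv : S.MeasurableControl v) :
    Measurable fun z : ℝ × Ω => S.batchDelay (v z.2) z.1 := by
  refine measurable_of_Ioi fun x => ?_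
  have : (fun z : ℝ × Ω => S.batchDelay (v z.2) z.1) ⁻¹' Ioi x = {_z | x < 0} ∪
      ⋃ (j : ℕ) (b : S.Request), (Prod.snd ⁻¹' {ω | ∃ p, (v ω)[j]? = some p ∧ p.2 = b} ∩
        {z | S.time v j z.2 = z.1}) ∩ {_z | x < S.δ b.1 b.2} := by
    ext z
    simp only [mem_preimage, mem_Ioi, S.lt_batchDelay_iff, mem_union, mem_iUnion]
    refine or_congr Iff.rfl ?_
    constructor
    · rintro ⟨p, hp, h1, h2⟩
      obtain ⟨j, hj⟩ := List.mem_iff_getElem?.1 hp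
      exact ⟨j, p.2, ⟨⟨p, hj, rfl⟩, (time_eq hj).trans h1⟩, h2⟩
    · rintro ⟨j, b, ⟨⟨p, hj, rfl⟩, h1⟩, h2⟩
      exact ⟨p, List.mem_iff_getElem?.2 ⟨j, hj⟩, (time_eq hj).symm.trans h1, h2⟩
  rw [this]
  refine (MeasurableSet.const _).union (MeasurableSet.iUnion fun j => MeasurableSet.iUnion fun b =>
    ((measurable_snd (hv.measurableSet_type j b)).inter ?_).inter (MeasurableSet.const _))
  exact measurableSet_eq_fun ((hv.measurable_time j).comp measurable_snd) measurable_fst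

lemma MeasurableControl.measurableSet_alphaB (hv : S.MeasurableControl v) (t : ℝ) (a : S.Mode)
    (w : ℝ) (b : S.Mode) : MeasurableSet {z : ℝ × Ω | S.alphaB t a w (v z.2) z.1 = b} := by
  have : {z : ℝ × Ω | S.alphaB t a w (v z.2) z.1 = b} =
      ⋂ k, {z | S.alphaB t a w (v z.2) z.1 k = b k} := by
    ext z; simp only [mem_iInter]; exact funext_iff
  rw [this]
  -- Each event is treated as a `Prop`-valued function, so that the principle for last requests
  -- applies.
  refine MeasurableSet.iInter fun k => measurableSet_setOfPred.2 ?_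
  refine hv.measurable_of_lastTo k
    (g₀ := fun z => (match a k with
      | Sum.inl l => Sum.inl l
      | Sum.inr e => if z.1 < t + w then Sum.inr e else Sum.inl e.1.2 : S.GenMode k) = b k)
    (g := fun e y => (if y.2.1 < y.1 + S.batchDelay (v y.2.2) y.1 then Sum.inr e
      else Sum.inl e.1.2 : S.GenMode k) = b k) ?_ ?_ ?_ ?_
  · rcases a k with l | e
    · exact measurable_const (a := ((Sum.inl l : S.GenMode k) = b k))
    · simp only [apply_ite (· = b k)]
      exact Measurable.ite (measurableSet_lt measurable_fst measurable_const)
        measurable_const measurable_const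
  · intro e
    simp only [apply_ite (· = b k)]
    refine Measurable.ite (measurableSet_lt (by fun_prop) ?_) measurable_const measurable_const
    exact measurable_fst.add (hv.measurable_batchDelay.comp
      (measurable_fst.prodMk (measurable_snd.comp measurable_snd)))
  · intro z hz
    simp only [alphaB, hz]
  · intro z τ e hz
    simp only [alphaB, hz]

lemma MeasurableControl.measurable_rho (hv : S.MeasurableControl v) (t w : ℝ) :
    Measurable fun z : ℝ × Ω => S.rho t w (v z.2) z.1 := by
  classical
  refine hv.measurable_of_last univ (g₀ := fun z => max 0 (w - (z.1 - t)) + 0)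
    (g := fun _ y => max 0 (w - (y.2.1 - t)) +
      max 0 (S.batchDelay (v y.2.2) y.1 - (y.2.1 - y.1))) (by fun_prop) ?_ ?_ ?_
  · intro b _
    have : Measurable fun y : ℝ × (ℝ × Ω) => S.batchDelay (v y.2.2) y.1 :=
      hv.measurable_batchDelay.comp (measurable_fst.prodMk (measurable_snd.comp measurable_snd))
    fun_prop
  · intro z hz
    have hl : ((v z.2).filter fun p => p.1 ≤ z.1).getLast? = none := by
      rw [List.getLast?_eq_none_iff, List.filter_eq_nil_iff]
      intro p hp
      simpa using hz p hp (mem_univ _)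
    simp only [rho]
    split
    · rename_i heq; rw [hl] at heq; cases heq
    · rfl
  · intro z j p hj _ hle hlast
    have hl : ((v z.2).filter fun p => p.1 ≤ z.1).getLast? = some p := by
      refine (List.getLast?_filter_eq_some_iff ..).2 ⟨j, hj, by simpa using hle, ?_⟩
      intro j' hj' p' hp'
      simpa using hlast j' hj' p' hp' (mem_univ _)
    simp only [rho]
    split
    · rename_i heq; rw [hl] at heq; cases heq; rfl
    · rename_i heq; rw [hl] at heq; cases heq

/-- The production curve of a transition, extended by constants. -/
def rampExt (S : Generators nG) (k : Fin nG) (e : S.Edge k) : ℝ → ℝ :=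
  IccExtend (S.δ_pos k e e.2).le ((Icc 0 (S.δ k e)).domRestrict (S.ramp k e))

omit [MeasurableSpace Ω] in
lemma continuous_rampExt (k : Fin nG) (e : S.Edge k) : Continuous (S.rampExt k e) :=
  (continuousOn_iff_continuous_domRestrict.1 (S.ramp_continuousOn e.2)).Icc_extend'

lemma rampExt_eq (k : Fin nG) (e : S.Edge k) {u : ℝ} (hu : u ∈ Icc 0 (S.δ k e)) :
    S.rampExt k e u = S.ramp k e u :=
  IccExtend_of_mem _ _ hu

-- The value `0` before `t` avoids arguments of an initial transition outside `[0, δ]`, where the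
-- curve is arbitrary; from `t` on it agrees with its continuous extension.
open Classical in
lemma MeasurableControl.measurable_zeta (hv : S.MeasurableControl v) (t : ℝ) {a : S.Mode}
    {r : Fin nG → ℝ} (hr : r ∈ S.H a) :
    Measurable fun z : ℝ × Ω => if t ≤ z.1 then
      S.zeta (S.alpha t a r (v z.2) z.1) (S.xi t a r (v z.2) z.1) else 0 := by
  refine measurable_pi_lambda _ fun k => ?_
  refine hv.measurable_of_lastTo k
    (g₀ := fun z => if t ≤ z.1 then
      (match a k with
      | Sum.inl l => S.θ k l
      | Sum.inr e => if z.1 < t - r k + S.δ k e then S.rampExt k e (z.1 - (t - r k))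
        else S.θ k e.1.2) else 0)
    (g := fun e y => if t ≤ y.2.1 then (if y.2.1 < y.1 + S.δ k e then S.rampExt k e (y.2.1 - y.1)
      else S.θ k e.1.2) else 0) ?_ ?_ ?_ ?_
  · refine Measurable.ite (measurableSet_le measurable_const measurable_fst) ?_ measurable_const
    rcases a k with l | e
    · exact measurable_const
    · exact Measurable.ite (measurableSet_lt measurable_fst measurable_const)
        ((continuous_rampExt k e).measurable.comp (by fun_prop)) measurable_const
  · intro e
    refine Measurable.ite (measurableSet_le measurable_const (by fun_prop)) ?_ measurable_const
    exact Measurable.ite (measurableSet_lt (by fun_prop) (by fun_prop))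
      ((continuous_rampExt k e).measurable.comp (by fun_prop)) measurable_const
  · intro z hz
    by_cases ht : t ≤ z.1
    · simp only [ht, if_true, zeta, alpha, xi, hz]
      have hrk := S.nonneg_of_mem_H hr k
      rcases a k with l | e
      · rfl
      · by_cases hc : z.1 < t - r k + S.δ k e
        · simp only [hc, if_true]
          rw [rampExt_eq k e ⟨by linarith, by linarith⟩]
        · simp only [hc, if_false]
    · simp [ht]
  · intro z τ e hz
    by_cases ht : t ≤ z.1
    · have := (S.lastTo_mem hz).2
      simp only [ht, if_true, zeta, alpha, xi, hz]
      by_cases hc : z.1 < τ + S.δ k e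
      · simp only [hc, if_true]
        rw [rampExt_eq k e ⟨by linarith, by linarith⟩]
      · simp only [hc, if_false]
    · simp [ht]

omit [MeasurableSpace Ω] in
lemma switchCost_eq {T t : ℝ} {ℓ : S.Requests} (h : ∀ p ∈ ℓ, t ≤ p.1 ∧ p.1 ≤ T) :
    S.switchCost T t ℓ = ((ℓ.map Prod.snd).map fun b => S.K b.1 b.2).sum := by
  classical
  unfold switchCost
  rw [List.filter_eq_self.2 fun p hp => by simpa using h p hp, List.map_map]
  rfl

/-- With all times in `[t, T]` the cost depends only on the sequence of request types, which takes
countably many values. -/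
lemma MeasurableControl.measurable_switchCost (hv : S.MeasurableControl v) {T t : ℝ}
    (h : ∀ ω, ∀ p ∈ v ω, t ≤ p.1 ∧ p.1 ≤ T) : Measurable fun ω => S.switchCost T t (v ω) := by
  refine measurable_of_countable_cover (ι := List S.Request)
    (A := fun bs => {ω | (v ω).map Prod.snd = bs})
    (g := fun bs _ => (bs.map fun b => S.K b.1 b.2).sum) ?_ (fun ω => ⟨_, rfl⟩)
    (fun _ => measurable_const) ?_
  · intro bs
    have : {ω | (v ω).map Prod.snd = bs} = ⋂ j : ℕ, {ω | (v ω)[j]?.map Prod.snd = bs[j]?} := by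
      ext ω
      simp only [mem_iInter]
      constructor
      · rintro h j
        have h' : (v ω).map Prod.snd = bs := h
        change (v ω)[j]?.map Prod.snd = bs[j]?
        rw [← h', List.getElem?_map]
      · intro h
        refine List.ext_getElem? fun j => ?_
        rw [List.getElem?_map]
        exact h j
    rw [this]
    refine MeasurableSet.iInter fun j => ?_
    rcases hb : bs[j]? with _ | b
    · have : {ω | (v ω)[j]?.map Prod.snd = none} =
          (⋃ b, {ω | ∃ p, (v ω)[j]? = some p ∧ p.2 = b})ᶜ := by
        ext ω
        simp only [mem_compl_iff, mem_iUnion]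
        change Option.map Prod.snd (v ω)[j]? = none ↔ ¬ ∃ b, ∃ p, (v ω)[j]? = some p ∧ p.2 = b
        rcases (v ω)[j]? with _ | p <;> simp
      rw [this]
      exact (MeasurableSet.iUnion fun b => hv.measurableSet_type j b).compl
    · have : {ω | (v ω)[j]?.map Prod.snd = some b} =
          {ω | ∃ p, (v ω)[j]? = some p ∧ p.2 = b} := by
        ext ω
        change Option.map Prod.snd (v ω)[j]? = some b ↔ ∃ p, (v ω)[j]? = some p ∧ p.2 = b
        rcases (v ω)[j]? with _ | p <;> simp
      rw [this]
      exact hv.measurableSet_type j b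
  · rintro bs ω rfl
    exact switchCost_eq (h ω)

omit [MeasurableSpace Ω] in
lemma switchCost_nonneg (T t : ℝ) (ℓ : S.Requests) : 0 ≤ S.switchCost T t ℓ := by
  unfold switchCost
  refine List.sum_nonneg fun x hx => ?_
  obtain ⟨p, -, rfl⟩ := List.mem_map.1 hx
  exact S.K_nonneg _ _ p.2.2.2

omit [MeasurableSpace Ω] in
/-- In the upper bound problem the switching costs are bounded. -/
lemma exists_switchCost_le (S : Generators nG) (T t : ℝ) : ∃ C : ℝ, ∀ a w (ℓ : S.Requests),
    0 ≤ w → S.PathAdmissibleB T t a w ℓ → S.switchCost T t ℓ ≤ C := by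
  obtain ⟨c, hc, hδ⟩ : ∃ c > 0, ∀ b : S.Request, c ≤ S.δ b.1 b.2 := by
    rcases isEmpty_or_nonempty S.Request with h | h
    · exact ⟨1, one_pos, fun b => h.elim b⟩
    · obtain ⟨b, hb⟩ := Finite.exists_min fun b : S.Request => S.δ b.1 b.2
      exact ⟨_, S.δ_pos b.1 b.2 b.2.2, hb⟩
  obtain ⟨M, hM⟩ : ∃ M : ℝ, ∀ b : S.Request, S.K b.1 b.2 ≤ M := by
    obtain ⟨M, hM⟩ := (Set.finite_range fun b : S.Request => S.K b.1 b.2).bddAbove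
    exact ⟨M, fun b => hM ⟨b, rfl⟩⟩
  -- Requests to one generator are at least the minimal delay `c` apart, so each time bin of length
  -- `c` holds at most one: (generator, bin) is injective on requests.
  set N := nG * (⌊(T - t) / c⌋₊ + 1) with hN
  refine ⟨N * |M|, fun a w ℓ hw h => ?_⟩
  obtain ⟨ho, hT, -, hsep⟩ := h
  have ht : ∀ p ∈ ℓ, t ≤ p.1 ∧ p.1 ≤ T := fun p hp => ⟨by linarith [(hT p hp).1], (hT p hp).2⟩
  have hlen : ℓ.length ≤ N := by
    have hgap : ∀ i j : Fin ℓ.length, i < j → (ℓ[i]).2.1 = (ℓ[j]).2.1 →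
        ⌊((ℓ[i]).1 - t) / c⌋₊ < ⌊((ℓ[j]).1 - t) / c⌋₊ := by
      intro i j hij hk
      have hi : ℓ[i] ∈ ℓ := List.getElem_mem _
      have hj : ℓ[j] ∈ ℓ := List.getElem_mem _
      have h1 := (List.pairwise_iff_getElem.1 ho i j i.2 j.2 hij).2 hk
      have h2 := hsep _ hi _ hj h1
      have h3 := S.delay_le_batchDelay hi
      have h4 := hδ (ℓ[i]).2
      have h5 : 0 ≤ ((ℓ[i]).1 - t) / c := div_nonneg (by linarith [(ht _ hi).1]) hc.le
      rw [Nat.lt_iff_add_one_le, ← Nat.floor_add_one h5]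
      refine Nat.floor_le_floor ?_
      rw [div_add_one hc.ne']
      gcongr
      linarith
    let F : Fin ℓ.length → Fin nG × Fin (⌊(T - t) / c⌋₊ + 1) := fun i =>
      ((ℓ[i]).2.1, ⟨⌊((ℓ[i]).1 - t) / c⌋₊, by
        have := (ht _ (List.getElem_mem i.2)).2
        refine Nat.lt_succ_of_le (Nat.floor_le_floor ?_)
        gcongr
        exact this⟩)
    have hF : Function.Injective F := by
      intro i j hij
      simp only [F, Prod.mk.injEq, Fin.mk.injEq] at hij
      rcases lt_trichotomy i j with h | h | h
      · exact absurd hij.2 (hgap i j h hij.1).ne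
      · exact h
      · exact absurd hij.2 (hgap j i h hij.1.symm).ne'
    simpa [hN] using Fintype.card_le_of_injective F hF
  rw [switchCost_eq ht]
  have h1 := List.sum_le_card_nsmul (((ℓ.map Prod.snd).map fun b => S.K b.1 b.2)) |M| (by
    intro x hx
    obtain ⟨b, -, rfl⟩ := List.mem_map.1 hx
    exact (hM b).trans (le_abs_self M))
  refine h1.trans ?_
  rw [nsmul_eq_mul]
  refine mul_le_mul_of_nonneg_right ?_ (abs_nonneg M)
  simpa using hlen

end Generators
end PowerOps

/-! ### Law, rotation invariance and integrability of the noise -/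

namespace PowerOps

namespace IsStdBrownian

variable {n : ℕ} {Ω : Type*} [MeasurableSpace Ω] {P : Measure Ω} {W W' : ℝ≥0 → Ω → Load n}

/-- An orthogonal transformation of a Brownian motion is a Brownian motion. -/
lemma map_isometry (hW : IsStdBrownian P W) (Q : Load n ≃ₗᵢ[ℝ] Load n) :
    IsStdBrownian P fun t ω => Q (W t ω) where
  measurable t := Q.continuous.measurable.comp (hW.measurable t)
  zero ω := by simp [hW.zero ω]
  cont ω := Q.continuous.comp (hW.cont ω)
  indep := hW.indep.map (Q.toContinuousLinearEquiv : Load n →L[ℝ] Load n)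
  law s t hst := by
    have hm : Measurable fun ω => W t ω - W s ω := (hW.measurable t).sub (hW.measurable s)
    have hQ : Measurable Q := Q.continuous.measurable
    refine ⟨?_, ?_⟩
    · exact ((hQ.comp (hW.measurable t)).sub (hQ.comp (hW.measurable s))).aemeasurable
    · have e : (fun ω => Q (W t ω) - Q (W s ω)) = Q ∘ fun ω => W t ω - W s ω := by
        funext ω; simp
      have e2 : (fun z : Load n => Real.sqrt ((t : ℝ) - s) • z) ∘ Q =
          Q ∘ fun z : Load n => Real.sqrt ((t : ℝ) - s) • z := by
        funext z; simp
      rw [e, ← Measure.map_map hQ hm, (hW.law s t hst).map_eq, Measure.map_map hQ (by fun_prop),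
        ← e2, ← Measure.map_map (by fun_prop) hQ, stdGaussian_map]

/-- The law of Brownian motion is unique. -/
lemma map_eq [IsProbabilityMeasure P] (hW : IsStdBrownian P W) (hW' : IsStdBrownian P W') :
    P.map (fun ω t => W t ω) = P.map (fun ω t => W' t ω) := by
  refine (map_eq_iff_forall_finset_map_restrict_eq
    (measurable_pi_lambda _ hW.measurable).aemeasurable
    (measurable_pi_lambda _ hW'.measurable).aemeasurable).2 fun I => ?_
  -- The times of `I` in increasing order, preceded by `0`; as `W 0 = 0`, the values on `I` are the
  -- partial sums `L` of independent increments. If `0 ∈ I`, the first increment is trivial.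
  set t : Fin (I.card + 1) → ℝ≥0 := Fin.cons 0 (I.orderEmbOfFin rfl) with ht
  have ht0 : t 0 = 0 := rfl
  have htm : Monotone t := by
    intro i j hij
    induction i using Fin.cases with
    | zero => exact zero_le
    | succ i =>
      induction j using Fin.cases with
      | zero => exact absurd hij (by simp)
      | succ j => exact (I.orderEmbOfFin rfl).monotone (by simpa using hij)
  set L : (Fin I.card → Load n) → I → Load n :=
    fun x i => ∑ j ∈ Finset.Iic ((I.orderIsoOfFin rfl).symm i), x j with hL
  have hLm : Measurable L := by
    refine measurable_pi_lambda _ fun i => ?_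
    exact Finset.measurable_sum _ fun j _ => measurable_pi_apply j
  have key : ∀ B : ℝ≥0 → Ω → Load n, IsStdBrownian P B →
      P.map (fun ω => I.restrict (B · ω)) = (Measure.pi fun i : Fin I.card =>
        (stdGaussian (Load n)).map fun z =>
          Real.sqrt ((t i.succ : ℝ) - t i.castSucc) • z).map L := by
    intro B hB
    have hinc : ∀ i : Fin I.card, Measurable fun ω => B (t i.succ) ω - B (t i.castSucc) ω :=
      fun i => (hB.measurable _).sub (hB.measurable _)
    have e : (fun ω => I.restrict (B · ω)) =
        L ∘ fun ω (i : Fin I.card) => B (t i.succ) ω - B (t i.castSucc) ω := by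
      funext ω i
      simp only [hL, Function.comp_apply, Finset.restrict]
      rw [Fin.sum_Iic_sub _ fun j => B (t j) ω, ht0, hB.zero, sub_zero]
      congr 1
      have : ((I.orderIsoOfFin rfl) ((I.orderIsoOfFin rfl).symm i) : ℝ≥0) = i := by simp
      simp only [ht, Fin.cons_succ]
      exact this.symm
    rw [e, ← Measure.map_map hLm (measurable_pi_lambda _ hinc),
      (iIndepFun_iff_map_fun_eq_pi_map fun i => (hinc i).aemeasurable).1 (hB.indep _ t htm)]
    congr 2
    funext i
    exact (hB.law _ _ (htm (Fin.castSucc_le_succ i))).map_eq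
  rw [key W hW, key W' hW']

end IsStdBrownian

/-- Continuous vector-valued paths. -/
abbrev VecPath (n : ℕ) := {w : ℝ≥0 → Load n // Continuous w}

section Path

variable {n : ℕ} {Ω : Type*} [MeasurableSpace Ω] {P : Measure Ω} {W W' : ℝ≥0 → Ω → Load n}

/-- The path of a continuous process. -/
def vecPath (hW : ∀ ω, Continuous fun t => W t ω) (ω : Ω) : VecPath n := ⟨fun t => W t ω, hW ω⟩

lemma measurable_vecPath (hW : ∀ ω, Continuous fun t => W t ω) (hm : ∀ t, Measurable (W t)) :
    Measurable (vecPath hW) :=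
  (measurable_pi_lambda _ hm).subtype_mk

/-- Events on the continuous path space are traces of product events, so equality of laws on the
product space suffices. -/
lemma map_vecPath_eq [IsProbabilityMeasure P] (hW : IsStdBrownian P W) (hW' : IsStdBrownian P W') :
    P.map (vecPath hW.cont) = P.map (vecPath hW'.cont) := by
  refine Measure.ext fun A hA => ?_
  obtain ⟨B, hB, rfl⟩ := hA
  have h := congrArg (fun μ => μ B) (hW.map_eq hW')
  simp only [Measure.map_apply (measurable_pi_lambda _ hW.measurable) hB,
    Measure.map_apply (measurable_pi_lambda _ hW'.measurable) hB] at h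
  rw [Measure.map_apply (measurable_vecPath hW.cont hW.measurable) (measurable_subtype_coe hB),
    Measure.map_apply (measurable_vecPath hW'.cont hW'.measurable) (measurable_subtype_coe hB)]
  exact h

lemma measurable_noise (A : Load n →L[ℝ] Load n) (hm : ∀ t, Measurable (W t)) (t s : ℝ) :
    Measurable (noise A W t s) :=
  A.continuous.measurable.comp ((hm _).sub (hm _))

lemma measurable_uncurry_noise (A : Load n →L[ℝ] Load n) (hW : ∀ ω, Continuous fun t => W t ω)
    (hm : ∀ t, Measurable (W t)) (t : ℝ) : Measurable (Function.uncurry (noise A W t)) :=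
  measurable_uncurry_of_continuous_of_measurable (fun ω => noise_continuous A (hW ω) t)
    (measurable_noise A hm t)

lemma measurable_ou (γ : ℝ) (A : Load n →L[ℝ] Load n) (hW : ∀ ω, Continuous fun t => W t ω)
    (hm : ∀ t, Measurable (W t)) (t : ℝ) (z : Load n) (s : ℝ) : Measurable (ou γ A W t z s) := by
  have h1 : Measurable fun ω => ∫ u in t..max s t, Real.exp (γ * (u - t)) • noise A W t u ω := by
    simp only [intervalIntegral.integral_of_le (le_max_right s t)]
    have h2 : Measurable fun y : Ω × ℝ => Real.exp (γ * (y.2 - t)) • noise A W t y.2 y.1 := by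
      have := (measurable_uncurry_noise A hW hm t).comp measurable_swap
      exact (by fun_prop : Measurable fun y : Ω × ℝ => Real.exp (γ * (y.2 - t))).smul this
    exact h2.stronglyMeasurable.integral_prod_right'.measurable
  have h3 : Measurable fun ω => Real.exp (-γ * (max s t - t)) •
      (z - γ • ∫ u in t..max s t, Real.exp (γ * (u - t)) • noise A W t u ω) := by fun_prop
  exact h3.add (measurable_noise A hm t _)

lemma measurable_uncurry_ou (γ : ℝ) (A : Load n →L[ℝ] Load n)
    (hW : ∀ ω, Continuous fun t => W t ω) (hm : ∀ t, Measurable (W t)) (t : ℝ) (z : Load n) :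
    Measurable (Function.uncurry (ou γ A W t z)) :=
  measurable_uncurry_of_continuous_of_measurable (fun ω => ou_continuous γ A (hW ω) t z)
    (measurable_ou γ A hW hm t z)

omit [MeasurableSpace Ω] in
lemma map_ou (L : Load n →L[ℝ] Load n) (γ : ℝ) (A : Load n →L[ℝ] Load n) {ω : Ω}
    (hW : Continuous fun t => W t ω) (t : ℝ) (z : Load n) (s : ℝ) :
    L (ou γ A W t z s ω) = ou γ (L.comp A) W t (L z) s ω := by
  have hg : Continuous fun u => Real.exp (γ * (u - t)) • noise A W t u ω := by
    have := noise_continuous A hW t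
    fun_prop
  have h := L.intervalIntegral_comp_comm (hg.intervalIntegrable (μ := volume) t (max s t))
  have hn : ∀ u, noise (L.comp A) W t u ω = L (noise A W t u ω) := fun u => rfl
  simp only [ou, map_add, map_smul, map_sub, hn, ← h]

omit [MeasurableSpace Ω] in
lemma ou_comp (γ : ℝ) (A Q : Load n →L[ℝ] Load n) (t : ℝ) (z : Load n) (s : ℝ) (ω : Ω) :
    ou γ (A.comp Q) W t z s ω = ou γ A (fun r ω => Q (W r ω)) t z s ω := by
  have hn : ∀ u, noise (A.comp Q) W t u ω = noise A (fun r ω => Q (W r ω)) t u ω := by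
    intro u; simp [noise]
  simp only [ou, hn]

/-- The path of the norm of the Ornstein–Uhlenbeck process with unit volatility. -/
def normPath (γ : ℝ) (hW : ∀ ω, Continuous fun t => W t ω) (t : ℝ) (z : Load n) (ω : Ω) :
    PathSpace :=
  ⟨fun s => ‖ou γ (ContinuousLinearMap.id ℝ _) W t z s ω‖, (ou_continuous γ _ (hW ω) t z).norm⟩

lemma measurable_normPath (γ : ℝ) (hW : ∀ ω, Continuous fun t => W t ω)
    (hm : ∀ t, Measurable (W t)) (t : ℝ) (z : Load n) : Measurable (normPath γ hW t z) :=
  (measurable_pi_lambda _ fun s => (measurable_ou γ _ hW hm t z s).norm).subtype_mk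

/-- Rotation invariance: the law of the norm only depends on the norm of the initial value. -/
lemma map_normPath_eq [IsProbabilityMeasure P] (hW : IsStdBrownian P W) (γ t : ℝ) {z z' : Load n}
    (h : ‖z‖ = ‖z'‖) : P.map (normPath γ hW.cont t z) = P.map (normPath γ hW.cont t z') := by
  -- A reflection exchanging two vectors of equal norm.
  obtain ⟨Q, hQ⟩ : ∃ Q : Load n ≃ₗᵢ[ℝ] Load n, Q z = z' := ⟨_, Submodule.reflection_sub h⟩
  have hcan : ∀ w : VecPath n, Continuous fun r : ℝ≥0 => w.1 r := fun w => w.2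
  have hmcan : ∀ r : ℝ≥0, Measurable fun w : VecPath n => w.1 r := fun r =>
    (measurable_pi_apply r).comp measurable_subtype_coe
  have hF : Measurable (normPath (W := fun r (w : VecPath n) => w.1 r) γ hcan t z') :=
    measurable_normPath γ hcan hmcan t z'
  have hW' := hW.map_isometry Q
  have e1 : normPath γ hW.cont t z' =
      normPath (W := fun r (w : VecPath n) => w.1 r) γ hcan t z' ∘ vecPath hW.cont := rfl
  -- Applying `Q` preserves the norm, starts the process at `z'` and replaces `W` by `Q W`: the same
  -- path functional is evaluated at another Brownian motion.
  have e2 : normPath γ hW.cont t z =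
      normPath (W := fun r (w : VecPath n) => w.1 r) γ hcan t z' ∘ vecPath hW'.cont := by
    funext ω
    refine Subtype.ext (funext fun s => ?_)
    set q : Load n →L[ℝ] Load n := (Q.toContinuousLinearEquiv : Load n →L[ℝ] Load n) with hq
    have h1 := map_ou q γ (ContinuousLinearMap.id ℝ _) (hW.cont ω) t z s
    have h2 := ou_comp (W := W) γ (ContinuousLinearMap.id ℝ _) q t (q z) s ω
    have h3 : q.comp (ContinuousLinearMap.id ℝ (Load n)) =
      (ContinuousLinearMap.id ℝ (Load n)).comp q := by ext; rfl
    rw [h3, h2] at h1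
    have h4 : ‖q (ou γ (ContinuousLinearMap.id ℝ (Load n)) W t z s ω)‖ =
      ‖ou γ (ContinuousLinearMap.id ℝ (Load n)) W t z s ω‖ := Q.norm_map _
    have h5 : q z = z' := hQ
    rw [h5] at h1
    change ‖ou γ (ContinuousLinearMap.id ℝ (Load n)) W t z s ω‖ = _
    rw [← h4, h1]
    rfl
  rw [e1, e2, ← Measure.map_map hF (measurable_vecPath hW.cont hW.measurable),
    ← Measure.map_map hF (measurable_vecPath hW'.cont hW'.measurable), map_vecPath_eq hW hW']

/-- Integrability of the noise over a bounded time interval. -/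
lemma integrable_noise [IsProbabilityMeasure P] (hW : IsStdBrownian P W)
    (A : Load n →L[ℝ] Load n) {t T : ℝ} (ht : 0 ≤ t) :
    Integrable (Function.uncurry (noise A W t)) ((volume.restrict (Ioc t T)).prod P) := by
  have hmeas := measurable_uncurry_noise A hW.cont hW.measurable t
  have hG : Integrable (fun z : Load n => z) (stdGaussian (Load n)) := IsGaussian.integrable_id
  -- The first moment of an increment scales like `√(s - t)`, which is bounded on the interval.
  have hlaw : ∀ s, t ≤ s → Integrable (fun ω => W s.toNNReal ω - W t.toNNReal ω) P ∧
      ∫ ω, ‖W s.toNNReal ω - W t.toNNReal ω‖ ∂P =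
        Real.sqrt (s - t) * ∫ z, ‖z‖ ∂(stdGaussian (Load n)) := by
    intro s hs
    have hl := hW.law t.toNNReal s.toNNReal (Real.toNNReal_le_toNNReal hs)
    rw [Real.coe_toNNReal _ ht, Real.coe_toNNReal _ (ht.trans hs)] at hl
    constructor
    · have h1 : Integrable (fun z : Load n => z)
          ((stdGaussian (Load n)).map fun z => Real.sqrt (s - t) • z) := by
        rw [integrable_map_measure (by fun_prop) (by fun_prop)]
        exact hG.smul (Real.sqrt (s - t))
      rw [← hl.map_eq, integrable_map_measure (by fun_prop) hl.aemeasurable] at h1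
      exact h1
    · have h1 : ∫ z, ‖z‖ ∂((stdGaussian (Load n)).map fun z => Real.sqrt (s - t) • z) =
          Real.sqrt (s - t) * ∫ z, ‖z‖ ∂(stdGaussian (Load n)) := by
        rw [integral_map (by fun_prop) (by fun_prop)]
        simp only [norm_smul, Real.norm_of_nonneg (Real.sqrt_nonneg _)]
        rw [integral_const_mul]
      rw [← hl.map_eq, integral_map hl.aemeasurable (by fun_prop)] at h1
      exact h1
  rw [integrable_prod_iff hmeas.aestronglyMeasurable]
  constructor
  · filter_upwards [ae_restrict_mem measurableSet_Ioc] with s hs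
    exact A.integrable_comp (hlaw s hs.1.le).1
  · refine Integrable.mono' (integrable_const (‖A‖ * (Real.sqrt (T - t) *
      ∫ z, ‖z‖ ∂(stdGaussian (Load n)))))
      hmeas.aestronglyMeasurable.norm.integral_prod_right' ?_
    filter_upwards [ae_restrict_mem measurableSet_Ioc] with s hs
    rw [Real.norm_of_nonneg (integral_nonneg fun _ => norm_nonneg _)]
    have h1 := hlaw s hs.1.le
    calc ∫ ω, ‖Function.uncurry (noise A W t) (s, ω)‖ ∂P
        ≤ ∫ ω, ‖A‖ * ‖W s.toNNReal ω - W t.toNNReal ω‖ ∂P :=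
          integral_mono (A.integrable_comp h1.1).norm (h1.1.norm.const_mul _)
            fun ω => A.le_opNorm _
      _ = ‖A‖ * (Real.sqrt (s - t) * ∫ z, ‖z‖ ∂(stdGaussian (Load n))) := by
          rw [integral_const_mul, h1.2]
      _ ≤ _ := by
          refine mul_le_mul_of_nonneg_left (mul_le_mul_of_nonneg_right
            (Real.sqrt_le_sqrt (by linarith [hs.2]))
            (integral_nonneg fun _ => norm_nonneg _)) (norm_nonneg _)

lemma integrable_ou [IsProbabilityMeasure P] (hW : IsStdBrownian P W) {γ : ℝ} (hγ : 0 ≤ γ)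
    (A : Load n →L[ℝ] Load n) {t T : ℝ} (ht : 0 ≤ t) (z : Load n) :
    Integrable (Function.uncurry (ou γ A W t z)) ((volume.restrict (Ioc t T)).prod P) := by
  have hN := integrable_noise (T := T) hW A ht
  have hint : Integrable (fun ω => ∫ u in Ioc t T, ‖noise A W t u ω‖) P :=
    hN.norm.integral_prod_right
  -- In the explicit solution the decaying factor is at most `1` because `γ ≥ 0`, and the growing
  -- one at most `exp (γ (T - t))`.
  have hdom : Integrable (fun y : ℝ × Ω => ‖z‖ + γ * (Real.exp (γ * (T - t)) *
      ∫ u in Ioc t T, ‖noise A W t u y.2‖) + ‖noise A W t y.1 y.2‖)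
      ((volume.restrict (Ioc t T)).prod P) :=
    ((integrable_const _).add (((hint.comp_snd _).const_mul _).const_mul _)).add hN.norm
  refine hdom.mono' (measurable_uncurry_ou γ A hW.cont hW.measurable t z).aestronglyMeasurable ?_
  have hmem : ∀ᵐ y : ℝ × Ω ∂((volume.restrict (Ioc t T)).prod P), y.1 ∈ Ioc t T :=
    Measure.quasiMeasurePreserving_fst.ae (ae_restrict_mem measurableSet_Ioc)
  filter_upwards [hmem] with y hy
  obtain ⟨s, ω⟩ := y
  have hs : s ∈ Ioc t T := hy
  have hcont := noise_continuous A (hW.cont ω) t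
  have h1 : ‖∫ u in t..max s t, Real.exp (γ * (u - t)) • noise A W t u ω‖ ≤
      Real.exp (γ * (T - t)) * ∫ u in Ioc t T, ‖noise A W t u ω‖ := by
    rw [max_eq_left hs.1.le, intervalIntegral.integral_of_le hs.1.le]
    refine (norm_integral_le_integral_norm _).trans ?_
    rw [← integral_const_mul]
    have hc1 : Continuous fun u => ‖Real.exp (γ * (u - t)) • noise A W t u ω‖ := by fun_prop
    have hc2 : Continuous fun u => Real.exp (γ * (T - t)) * ‖noise A W t u ω‖ := by fun_prop
    calc ∫ u in Ioc t s, ‖Real.exp (γ * (u - t)) • noise A W t u ω‖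
        ≤ ∫ u in Ioc t s, Real.exp (γ * (T - t)) * ‖noise A W t u ω‖ := by
          refine setIntegral_mono_on (hc1.integrableOn_Ioc) (hc2.integrableOn_Ioc)
            measurableSet_Ioc fun u hu => ?_
          rw [norm_smul, Real.norm_of_nonneg (Real.exp_pos _).le]
          refine mul_le_mul_of_nonneg_right (Real.exp_le_exp.2 ?_) (norm_nonneg _)
          exact mul_le_mul_of_nonneg_left (by linarith [hu.2, hs.2]) hγ
      _ ≤ ∫ u in Ioc t T, Real.exp (γ * (T - t)) * ‖noise A W t u ω‖ := by
          refine setIntegral_mono_set (hc2.integrableOn_Ioc) ?_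
            (Ioc_subset_Ioc_right hs.2).eventuallyLE
          exact Eventually.of_forall fun u => by positivity
  have h2 : Real.exp (-γ * (max s t - t)) ≤ 1 := by
    refine Real.exp_le_one_iff.2 ?_
    have : 0 ≤ max s t - t := by linarith [le_max_right s t]
    nlinarith
  change ‖ou γ A W t z s ω‖ ≤ _
  unfold ou
  refine (norm_add_le _ _).trans (add_le_add ?_ (by rw [max_eq_left hs.1.le]))
  rw [norm_smul, Real.norm_of_nonneg (Real.exp_pos _).le]
  refine (mul_le_of_le_one_left (norm_nonneg _) h2).trans ((norm_sub_le _ _).trans ?_)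
  rw [norm_smul, Real.norm_of_nonneg hγ]
  exact add_le_add le_rfl (mul_le_mul_of_nonneg_left h1 hγ)

end Path
end PowerOps

/-! ### Transfer of controls and comparison of costs -/

namespace PowerOps

section Adapted

variable {nG : ℕ} {S : Generators nG}

lemma past_le {Ω E : Type*} [MeasurableSpace Ω] [MeasurableSpace E] {Y : ℝ → Ω → E}
    (hY : ∀ s, Measurable (Y s)) (s : ℝ) : past Y s ≤ ‹MeasurableSpace Ω› :=
  iSup₂_le fun u _ => (hY u).comap_le

lemma IsAdaptedControl.measurableControl {Ω E : Type*} [MeasurableSpace Ω] [MeasurableSpace E]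
    {Y : ℝ → Ω → E} (hY : ∀ s, Measurable (Y s)) {v : Ω → S.Requests}
    (hv : IsAdaptedControl S Y v) : S.MeasurableControl v := fun j b s =>
  past_le hY s _ (hv.2 j b s)

/-- A control adapted to a process remains adapted when that process is recovered causally from
another one. -/
lemma IsAdaptedControl.comp {Ω Ω' E E' : Type*} [MeasurableSpace E] [MeasurableSpace E']
    {Y : ℝ → Ω → E} {Y' : ℝ → Ω' → E'} {v : Ω' → S.Requests} (hv : IsAdaptedControl S Y' v)
    {φ : Ω → Ω'} {g : ℝ → E → E'} (hg : ∀ s, Measurable (g s))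
    (hφ : ∀ s ω, Y' s (φ ω) = g s (Y s ω)) : IsAdaptedControl S Y (v ∘ φ) := by
  have key : ∀ s A, MeasurableSet[past Y' s] A → MeasurableSet[past Y s] (φ ⁻¹' A) := by
    intro s A hA
    -- Each `Y'_u ∘ φ` is a function of `Y_u` at the same time `u`, so no future information enters.
    have hle : (past Y' s).comap φ ≤ past Y s := by
      simp only [past, MeasurableSpace.comap_iSup, MeasurableSpace.comap_comp]
      refine iSup₂_mono fun u _ => ?_
      have : Y' u ∘ φ = g u ∘ Y u := funext fun ω => hφ u ω
      rw [this, ← MeasurableSpace.comap_comp]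
      exact MeasurableSpace.comap_mono (hg u).comap_le
    exact hle _ ⟨A, hA, rfl⟩
  exact ⟨fun j s => key s _ (hv.1 j s), fun j b s => key s _ (hv.2 j b s)⟩

end Adapted

lemma measurable_coord (s : ℝ) : Measurable (coord s) :=
  (measurable_pi_apply s).comp measurable_subtype_coe

lemma measurable_uncurry_coord : Measurable (Function.uncurry coord) :=
  measurable_uncurry_of_continuous_of_measurable (fun p => p.2) measurable_coord

namespace System

variable {nG nL nc : ℕ} (S : System nG nL nc)

/-- The forecast, extended by constants to all times. -/
def forecastExt : ℝ → Load nL := IccExtend S.T_nonneg ((Icc 0 S.T).domRestrict S.m)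

/-- The forecast is Lipschitz only on `[0, T]`; the extension supplies a globally measurable
version. -/
lemma continuous_forecastExt : Continuous S.forecastExt := by
  obtain ⟨C, hC, h⟩ := S.m_lipschitz
  have hm : ContinuousOn S.m (Icc 0 S.T) := by
    refine LipschitzOnWith.continuousOn (K := C.toNNReal) (LipschitzOnWith.of_dist_le_mul ?_)
    intro u hu v hv
    rw [dist_eq_norm, Real.dist_eq, Real.coe_toNNReal _ hC.le]
    exact h u hu v hv
  exact (continuousOn_iff_continuous_domRestrict.1 hm).Icc_extend'

lemma forecastExt_eq {s : ℝ} (hs : s ∈ Icc 0 S.T) : S.forecastExt s = S.m s :=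
  IccExtend_of_mem _ _ hs

variable {Ω : Type*} [MeasurableSpace Ω] {P : Measure Ω}

/-- The running cost of Problem UB is jointly measurable in time and the scenario. -/
lemma measurable_maxCostAt_process [NeZero nL] {v : Ω → S.Requests} (hv : S.MeasurableControl v)
    {y : ℝ × Ω → ℝ} (hy : Measurable y) (t : ℝ) (a : S.Mode) (w : ℝ) :
    Measurable fun z : ℝ × Ω => S.maxCostAt (S.forecastExt z.1) (y z)
      (S.alphaB t a w (v z.2) z.1) (S.rho t w (v z.2) z.1) := by
  let A : S.Mode → Set (ℝ × Ω) := fun b => {z | S.alphaB t a w (v z.2) z.1 = b}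
  let g : S.Mode → ℝ × Ω → ℝ := fun b z =>
    S.maxCostAt (S.forecastExt z.1) (y z) b (S.rho t w (v z.2) z.1)
  refine measurable_of_countable_cover (A := A) (g := g) (hv.measurableSet_alphaB t a w)
    (fun z => ⟨S.alphaB t a w (v z.2) z.1, rfl⟩) (fun b => ?_) ?_
  · have h1 : Measurable fun z : ℝ × Ω => ((S.forecastExt z.1, y z), S.rho t w (v z.2) z.1) :=
      ((S.continuous_forecastExt.measurable.comp measurable_fst).prodMk hy).prodMk
        (hv.measurable_rho t w)
    have h2 := (S.measurable_maxCostAt b).comp h1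
    exact h2
  · intro b z hz
    have hz' : S.alphaB t a w (v z.2) z.1 = b := hz
    simp only [g, hz']

open Classical in
/-- The running cost of Problem 1 is jointly measurable in time and the scenario. -/
lemma measurable_runCost_process {v : Ω → S.Requests} (hv : S.MeasurableControl v)
    {ζ : ℝ × Ω → Load nL} (hζ : Measurable ζ) (t : ℝ) {a : S.Mode} {r : Fin nG → ℝ}
    (hr : r ∈ S.H a) :
    Measurable fun z : ℝ × Ω => S.runCost (S.forecastExt z.1 + ζ z)
      (if t ≤ z.1 then S.zeta (S.alpha t a r (v z.2) z.1) (S.xi t a r (v z.2) z.1) else 0) :=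
  S.measurable_runCost.comp (((S.continuous_forecastExt.measurable.comp measurable_fst).add
    hζ).prodMk (hv.measurable_zeta t hr))

section

variable {W : ℝ≥0 → Ω → Load nL}

omit [MeasurableSpace Ω] in
-- Scalar mean reversion commutes with `σ⁻¹`, so the normalised error has unit volatility, to which
-- rotation invariance applies.
lemma sigInv_ou (hW : ∀ ω, Continuous fun t => W t ω) (t : ℝ) (z : Load nL) (s : ℝ) (ω : Ω) :
    S.sigInv (ou S.γ S.sig W t z s ω) =
      ou S.γ (ContinuousLinearMap.id ℝ _) W t (S.sigInv z) s ω := by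
  rw [map_ou S.sigInv S.γ S.sig (hW ω)]
  congr 1
  ext1 u
  exact S.sigInv_sig u

omit [MeasurableSpace Ω] in
lemma coord_normPath (hW : ∀ ω, Continuous fun t => W t ω) (t : ℝ) (x : Load nL) (s : ℝ) (ω : Ω) :
    coord s (normPath S.γ hW t (S.sigInv (x - S.m t)) ω) =
      ‖S.sigInv (S.X W t x s ω - S.m s)‖ := by
  rw [X, add_sub_cancel_left, S.sigInv_ou hW]
  rfl

/-- The reference start `‖u‖ e` and `u` have the same norm, so rotation invariance applies. -/
lemma lawB_eq [NeZero nL] [IsProbabilityMeasure P] (hW : IsStdBrownian P W) (t : ℝ) (u : Load nL) :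
    S.lawB P hW.cont t ‖u‖ = P.map (normPath S.γ hW.cont t u) := by
  have h1 : S.XBpath hW.cont t ‖u‖ =
      normPath S.γ hW.cont t (‖u‖ • EuclideanSpace.single (0 : Fin nL) (1 : ℝ)) := by
    funext ω
    refine Subtype.ext (funext fun s => ?_)
    simp only [XBpath, normPath]
    rw [S.sigInv_ou hW.cont, S.sigInv_sig]
  rw [lawB, h1]
  refine map_normPath_eq hW S.γ t ?_
  simp [norm_smul]

/-- The costs of Problem 1 are bounded below. -/
lemma bddBelow_J [IsProbabilityMeasure P] {t : ℝ} (ht : t ∈ Icc 0 S.T) (x : Load nL) {a : S.Mode}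
    {r : Fin nG → ℝ} (hr : r ∈ S.H a) :
    BddBelow (S.J P W t x a r '' S.Controls W t x a r) := by
  obtain ⟨M, hM0, hM⟩ := S.exists_le_f
  have hC : 0 ≤ M * (S.T - t) := mul_nonneg hM0 (by linarith [ht.2])
  refine ⟨-(M * (S.T - t)), ?_⟩
  rintro _ ⟨v, -, rfl⟩
  have hpt : ∀ ω, -(M * (S.T - t)) ≤
      (∫ s in t..S.T, S.f (S.X W t x s ω) (S.alpha t a r (v ω) s) (S.xi t a r (v ω) s)) +
      S.switchCost S.T t (v ω) := by
    intro ω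
    refine le_add_of_le_of_nonneg ?_ (Generators.switchCost_nonneg _ _ _)
    -- A non-integrable cost has integral `0`, which still respects the nonpositive bound.
    by_cases hi : IntervalIntegrable (fun s => S.f (S.X W t x s ω) (S.alpha t a r (v ω) s)
      (S.xi t a r (v ω) s)) volume t S.T
    · have h1 := intervalIntegral.integral_mono_on ht.2
        (intervalIntegrable_const (c := -M) (μ := volume)) hi
        fun s hs => hM _ _ _ (S.xi_mem_H hr (v ω) hs.1)
      rw [intervalIntegral.integral_const, smul_eq_mul] at h1
      linarith
    · rw [intervalIntegral.integral_undef hi]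
      linarith
  unfold J
  by_cases hi : Integrable (fun ω => (∫ s in t..S.T, S.f (S.X W t x s ω) (S.alpha t a r (v ω) s)
      (S.xi t a r (v ω) s)) + S.switchCost S.T t (v ω)) P
  · have := integral_mono (integrable_const (-(M * (S.T - t)))) hi hpt
    simpa using this
  · rw [integral_undef hi]
    linarith

omit [MeasurableSpace Ω] in
/-- A control of Problem UB, applied to the normalised forecast error, is a control of Problem 1. -/
lemma comp_normPath_mem_Controls (hW : ∀ ω, Continuous fun t => W t ω) (t : ℝ) (x : Load nL)
    {a : S.Mode} {r : Fin nG → ℝ} (hr : r ∈ S.H a) {v : PathSpace → S.Requests}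
    (hv : v ∈ S.ControlsB t a (S.psi a r)) :
    v ∘ normPath S.γ hW t (S.sigInv (x - S.m t)) ∈ S.Controls W t x a r := by
  refine ⟨hv.1.comp (g := fun s y => ‖S.sigInv (y - S.m s)‖) (fun s => ?_)
    (S.coord_normPath hW t x), fun ω => (hv.2 _).pathAdmissible S.toGenerators hr⟩
  have : Continuous fun y : Load nL => ‖S.sigInv (y - S.m s)‖ := by fun_prop
  exact this.measurable

/-- A control of Problem UB costs no less there than in Problem 1. -/
lemma J_comp_le_JB [NeZero nL] [IsProbabilityMeasure P] (hW : IsStdBrownian P W) {t : ℝ}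
    (ht : t ∈ Icc 0 S.T) (x : Load nL) {a : S.Mode} {r : Fin nG → ℝ} (hr : r ∈ S.H a)
    {v : PathSpace → S.Requests} (hv : v ∈ S.ControlsB t a (S.psi a r)) :
    S.J P W t x a r (v ∘ normPath S.γ hW.cont t (S.sigInv (x - S.m t))) ≤
      S.JB P hW.cont t ‖S.sigInv (x - S.m t)‖ a (S.psi a r) v := by
  classical
  set w := S.psi a r with hw
  set φ := normPath S.γ hW.cont t (S.sigInv (x - S.m t)) with hφ
  have hφm : Measurable φ := measurable_normPath S.γ hW.cont hW.measurable t _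
  set ν : Measure ℝ := volume.restrict (Ioc t S.T) with hν
  have hvm : S.MeasurableControl v := hv.1.measurableControl measurable_coord
  have hvφm : S.MeasurableControl (v ∘ φ) := fun j b s => hφm (hvm j b s)
  have htimes : ∀ p, ∀ q ∈ v p, t ≤ q.1 ∧ q.1 ≤ S.T := fun p q hq =>
    ⟨by linarith [S.psi_nonneg hr, ((hv.2 p).2.1 q hq).1], ((hv.2 p).2.1 q hq).2⟩
  have hext : ∀ s ∈ Ioc t S.T, S.forecastExt s = S.m s := fun s hs =>
    S.forecastExt_eq ⟨ht.1.trans hs.1.le, hs.2⟩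
  -- `hB` and `hF` are jointly measurable versions of the two running costs, equal to them on `(t,
  -- T]`.
  set hB : ℝ × PathSpace → ℝ := fun z => S.maxCostAt (S.forecastExt z.1) (coord z.1 z.2)
    (S.alphaB t a w (v z.2) z.1) (S.rho t w (v z.2) z.1) with hBdef
  have hBm : Measurable hB := S.measurable_maxCostAt_process hvm measurable_uncurry_coord t a w
  set hF : ℝ × Ω → ℝ := fun z => S.runCost (S.forecastExt z.1 + ou S.γ S.sig W t (x - S.m t) z.1 z.2)
    (if t ≤ z.1 then S.zeta (S.alpha t a r ((v ∘ φ) z.2) z.1) (S.xi t a r ((v ∘ φ) z.2) z.1) else 0)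
    with hFdef
  have hFm : Measurable hF := S.measurable_runCost_process hvφm
    (measurable_uncurry_ou S.γ S.sig hW.cont hW.measurable t _) t hr
  have hFeq : ∀ s ∈ Ioc t S.T, ∀ ω, S.f (S.X W t x s ω) (S.alpha t a r ((v ∘ φ) ω) s)
      (S.xi t a r ((v ∘ φ) ω) s) = hF (s, ω) := by
    intro s hs ω
    rw [S.f_eq_runCost _ (S.xi_mem_H hr _ hs.1.le)]
    simp only [hFdef, if_pos hs.1.le, hext s hs]
    rfl
  have hBeq : ∀ s ∈ Ioc t S.T, ∀ p, S.fB2 s (coord s p) (S.alphaB t a w (v p) s)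
      (S.rho t w (v p) s) = hB (s, p) := by
    intro s hs p
    rw [S.fB2_eq_maxCostAt, ← hext s hs]
  have hmem : ∀ᵐ z : ℝ × Ω ∂(ν.prod P), z.1 ∈ Ioc t S.T :=
    Measure.quasiMeasurePreserving_fst.ae (ae_restrict_mem measurableSet_Ioc)
  have hFint : Integrable hF (ν.prod P) := by
    obtain ⟨M, hM0, hM⟩ := S.exists_abs_f_le
    have h1 : Integrable (fun s => S.forecastExt s) ν :=
      S.continuous_forecastExt.integrableOn_Ioc
    have h2 := integrable_ou hW S.γ_nonneg S.sig ht.1 (x - S.m t) (T := S.T)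
    have h3 : Integrable (fun z : ℝ × Ω => M * (1 + (‖S.forecastExt z.1‖ +
        ‖ou S.γ S.sig W t (x - S.m t) z.1 z.2‖))) (ν.prod P) :=
      ((integrable_const _).add ((h1.norm.comp_fst P).add h2.norm)).const_mul M
    refine h3.mono' hFm.aestronglyMeasurable ?_
    filter_upwards [hmem] with z hz
    have h4 := hM (S.X W t x z.1 z.2) _ _ (S.xi_mem_H hr ((v ∘ φ) z.2) (le_of_lt hz.1))
    rw [hFeq z.1 hz z.2] at h4
    refine h4.trans (mul_le_mul_of_nonneg_left (add_le_add le_rfl ?_) hM0)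
    rw [X, ← hext z.1 hz]
    exact norm_add_le _ _
  have hBint : Integrable (fun z : ℝ × Ω => hB (z.1, φ z.2)) (ν.prod P) := by
    obtain ⟨M, hM0, hM⟩ := S.exists_abs_maxCostAt_le
    have h1 : Integrable (fun s => S.sigInv (S.forecastExt s)) ν :=
      (S.sigInv.continuous.comp S.continuous_forecastExt).integrableOn_Ioc
    have h2 := integrable_ou hW S.γ_nonneg (ContinuousLinearMap.id ℝ _) ht.1
      (S.sigInv (x - S.m t)) (T := S.T)
    have h3 : Integrable (fun z : ℝ × Ω => M * (1 + ‖S.sigInv (S.forecastExt z.1)‖ +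
        ‖ou S.γ (ContinuousLinearMap.id ℝ _) W t (S.sigInv (x - S.m t)) z.1 z.2‖)) (ν.prod P) :=
      (((integrable_const _).add (h1.norm.comp_fst P)).add h2.norm).const_mul M
    refine h3.mono' (hBm.comp (measurable_fst.prodMk
      (hφm.comp measurable_snd))).aestronglyMeasurable (Eventually.of_forall fun z => ?_)
    refine (hM _ _ _ _).trans_eq ?_
    congr 2
    exact abs_of_nonneg (norm_nonneg _)
  have hscm : Measurable fun p => S.switchCost S.T t (v p) := hvm.measurable_switchCost htimes
  have hscint : Integrable (fun ω => S.switchCost S.T t (v (φ ω))) P := by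
    obtain ⟨C, hC⟩ := Generators.exists_switchCost_le S.toGenerators S.T t
    refine Integrable.mono' (integrable_const C) (hscm.comp hφm).aestronglyMeasurable
      (Eventually.of_forall fun ω => ?_)
    rw [Real.norm_of_nonneg (Generators.switchCost_nonneg _ _ _)]
    exact hC a w _ (S.psi_nonneg hr) (hv.2 _)
  have hJ : S.J P W t x a r (v ∘ φ) =
      ∫ ω, ((∫ s, hF (s, ω) ∂ν) + S.switchCost S.T t (v (φ ω))) ∂P := by
    unfold J
    refine integral_congr_ae (Eventually.of_forall fun ω => ?_)
    simp only [intervalIntegral.integral_of_le ht.2]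
    congr 1
    exact setIntegral_congr_fun measurableSet_Ioc fun s hs => hFeq s hs ω
  -- Change of variables: `lawB` is the law of `φ`, so both costs become expectations over the same
  -- `Ω`.
  have hJB : S.JB P hW.cont t ‖S.sigInv (x - S.m t)‖ a w v =
      ∫ ω, ((∫ s, hB (s, φ ω) ∂ν) + S.switchCost S.T t (v (φ ω))) ∂P := by
    have hΦ : Measurable fun p => (∫ s, hB (s, p) ∂ν) + S.switchCost S.T t (v p) :=
      hBm.stronglyMeasurable.integral_prod_left'.measurable.add hscm
    unfold JB
    rw [S.lawB_eq hW, ← hφ, ← integral_map (f := fun p => (∫ s, hB (s, p) ∂ν) +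
      S.switchCost S.T t (v p)) hφm.aemeasurable hΦ.aestronglyMeasurable]
    refine integral_congr_ae (Eventually.of_forall fun p => ?_)
    simp only [intervalIntegral.integral_of_le ht.2]
    congr 1
    exact setIntegral_congr_fun measurableSet_Ioc fun s hs => hBeq s hs p
  rw [hJ, hJB]
  refine integral_mono_ae (hFint.integral_prod_right.add hscint)
    (hBint.integral_prod_right.add hscint) ?_
  -- Almost every scenario has integrable time sections, as monotonicity of the inner integral
  -- requires.
  filter_upwards [hFint.prod_left_ae, hBint.prod_left_ae] with ω h1 h2
  refine add_le_add (integral_mono_ae h1 h2 ?_) le_rfl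
  filter_upwards [ae_restrict_mem measurableSet_Ioc] with s hs
  rw [← hFeq s hs, ← hBeq s hs, hφ, S.coord_normPath hW.cont]
  exact S.f_le_maxCostAt s _ (S.zeta_mem_DGw_of_pathAdmissibleB hr (hv.2 _) hs.1.le)

/-- Never switching is admissible; otherwise the infimum would be the default `0`. -/
lemma ControlsB_nonempty (t : ℝ) (a : S.Mode) (w : ℝ) : (S.ControlsB t a w).Nonempty := by
  refine ⟨fun _ => [], ⟨fun j s => ?_, fun j b s => ?_⟩, fun p => ?_⟩
  · simp
  · simp
  · simp [Generators.PathAdmissibleB, Generators.Ordered, Generators.Respects]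

end

end System

end PowerOps

end

theorem mainTheorem5 {nG nL nc : ℕ} [NeZero nL] (S : PowerOps.System nG nL nc)
    {Ω : Type*} [MeasurableSpace Ω] (P : MeasureTheory.Measure Ω)
    [MeasureTheory.IsProbabilityMeasure P]
    (W : NNReal → Ω → PowerOps.Load nL) (hW : PowerOps.IsStdBrownian P W)
    (t : ℝ) (ht : t ∈ Set.Icc 0 S.T) (x : PowerOps.Load nL)
    (a : S.Mode) (r : Fin nG → ℝ) (hr : r ∈ S.H a) :
    S.VUB P hW.cont t ‖S.sigInv (x - S.m t)‖ a (S.psi a r) ≥ S.V P W t x a r := by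
  refine le_csInf ((S.ControlsB_nonempty t a _).image _) ?_
  rintro _ ⟨v, hv, rfl⟩
  exact (csInf_le (S.bddBelow_J ht x hr)
    ⟨_, S.comp_normPath_mem_Controls hW.cont t x hr hv, rfl⟩).trans (S.J_comp_le_JB hW ht x hr hv)
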